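/- Let $N=2^n$ with $n\ge 1$ an integer, $V_N=([0,N-1]\cap\mathbb Z)^2$, and let $V_N'=V_{N/2}+(\lfloor N/4\rfloor,\lfloor N/4\rfloor)\subset V_N$ be the central sub-box (the rounding matters only for $N=2$). For $k\ge 0$ call a translate $B=c+([0,2^k-1]\cap\mathbb Z)^2$, $c\in\mathbb Z^2$, a square of side $2^k$ with lower left corner $c$; let $\mathcal B_k(z)$ be the set of squares of side $2^k$ containing $z$, and $\mathcal B_k^N$ the set of squares of side $2^k$ with lower left corner in $V_N$. Let $\{b_{k,B}\}_{k\ge 0,\,B\in\mathcal B_k^N}$ be independent centered Gaussian random variables, $b_{k,B}$ having variance $2^{-2k}$. For an arbitrary square $B$ of side $2^k$ put $b^N_{k,B}=b_{k,B'}$, where $B'\in\mathcal B_k^N$ is the unique element of which $B$ is a translate by a vector of $(N\mathbb Z)^2$. The modified branching random walk (MBRW) is $$\mathcal S_z^N=\sum_{k=0}^n\ \sum_{B\in\mathcal B_k(z)} b^N_{k,B},\qquad z\in V_N .$$ Let $A_n=2\sqrt{\log 2}\,n-\frac{3}{4\sqrt{\log 2}}\log n$. Then there is a constant $\delta_0\in(0,1)$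 such that, for all $n\ge 1$ and $N=2^n$, $$P\Big(\max_{z\in V_N'}\mathcal S_z^N\ \ge\ A_n\Big)\ \ge\ \delta_0 .$$ -/

import Mathlib

open MeasureTheory ProbabilityTheory
open scoped NNReal

namespace MBRW

/-- The box `V_N = ([0, N-1] ∩ ℤ)²`. -/
noncomputable def box (N : ℕ) : Finset (ℤ × ℤ) :=
  Finset.Ico (0 : ℤ) N ×ˢ Finset.Ico (0 : ℤ) N

/-- The central sub-box `V_N' = V_{N/2} + (N/4, N/4)`. For `N` a power of two the divisions are
exact as soon as `4 ∣ N`; for `N = 2` the shift is rounded down. -/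
noncomputable def centralBox (N : ℕ) : Finset (ℤ × ℤ) :=
  (box (N / 2)).image fun z => z + (((N / 4 : ℕ) : ℤ), ((N / 4 : ℕ) : ℤ))

/-- The square of side `2 ^ k` in `ℤ²` with lower left corner `c`. -/
noncomputable def square (k : ℕ) (c : ℤ × ℤ) : Finset (ℤ × ℤ) :=
  Finset.Ico c.1 (c.1 + 2 ^ k) ×ˢ Finset.Ico c.2 (c.2 + 2 ^ k)

/-- The squares of side `2 ^ k` containing `z`, each recorded by its lower left corner
(see `mem_squaresAt`). -/
noncomputable def squaresAt (k : ℕ) (z : ℤ × ℤ) : Finset (ℤ × ℤ) :=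
  Finset.Ioc (z.1 - 2 ^ k) z.1 ×ˢ Finset.Ioc (z.2 - 2 ^ k) z.2

theorem mem_squaresAt (k : ℕ) (z c : ℤ × ℤ) : c ∈ squaresAt k z ↔ z ∈ square k c := by
  simp only [squaresAt, square, Finset.mem_product, Finset.mem_Ioc, Finset.mem_Ico]
  constructor <;> rintro ⟨⟨_, _⟩, _, _⟩ <;> refine ⟨⟨?_, ?_⟩, ?_, ?_⟩ <;> linarith

/-- The representative in `V_N` of `c` modulo `(N ℤ)²`. -/
def torusRep (N : ℕ) (c : ℤ × ℤ) : ℤ × ℤ := (c.1 % (N : ℤ), c.2 % (N : ℤ))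

theorem torusRep_mem {N : ℕ} (hN : 0 < N) (c : ℤ × ℤ) : torusRep N c ∈ box N := by
  have h : (0 : ℤ) < N := by exact_mod_cast hN
  simp [torusRep, box, Int.emod_nonneg _ h.ne', Int.emod_lt_of_pos _ h]

/-- `b k c` is the weight attached to the square of side `2 ^ k` with lower left corner `c`.
For `k ≥ 0` and `c ∈ V_N` these are independent centered Gaussian random variables, of variance
`2 ^ (-2k)`. Values of `b` at corners outside `V_N` are unconstrained and never used. -/
structure IsWeightFamily {Ω : Type*} [MeasurableSpace Ω] (P : Measure Ω) (N : ℕ)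
    (b : ℕ → ℤ × ℤ → Ω → ℝ) : Prop where
  hasLaw : ∀ k : ℕ, ∀ c ∈ box N, HasLaw (b k c) (gaussianReal 0 (((2 : ℝ≥0) ^ (2 * k))⁻¹)) P
  indep : iIndepFun (fun p : ℕ × {c : ℤ × ℤ // c ∈ box N} => b p.1 p.2.1) P

/-- The modified branching random walk on `V_N`, `N = 2 ^ n`: the sum over scales `0 ≤ k ≤ n` and
over all squares of side `2 ^ k` containing `z` of the weights, extended `N`-periodically. -/
noncomputable def mbrw {Ω : Type*} (n : ℕ) (b : ℕ → ℤ × ℤ → Ω → ℝ) (z : ℤ × ℤ) (ω : Ω) : ℝ :=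
  ∑ k ∈ Finset.range (n + 1), ∑ c ∈ squaresAt k z, b k (torusRep (2 ^ n) c) ω

theorem centralBox_nonempty {n : ℕ} (hn : 1 ≤ n) : (centralBox (2 ^ n)).Nonempty := by
  obtain ⟨m, rfl⟩ := Nat.exists_eq_add_of_le' hn
  refine Finset.Nonempty.image ⟨(0, 0), ?_⟩ _
  have h : 2 ^ (m + 1) / 2 = 2 ^ m := by rw [pow_succ]; simp
  rw [h]
  simp [box]

/-- The maximum of the modified branching random walk over the central sub-box. -/
noncomputable def centralMax {Ω : Type*} (n : ℕ) (hn : 1 ≤ n) (b : ℕ → ℤ × ℤ → Ω → ℝ) (ω : Ω) :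
    ℝ :=
  (centralBox (2 ^ n)).sup' (centralBox_nonempty hn) fun z => mbrw n b z ω

/-- `A_n = 2 √(log 2) n - (3 / (4 √(log 2))) log n`. -/
noncomputable def A (n : ℕ) : ℝ :=
  2 * √(Real.log 2) * n - 3 / (4 * √(Real.log 2)) * Real.log n

end MBRW

/-!
The proof is a second moment argument for a sum of weights, one for each point of the central box,
chosen so that all the expectations are explicit.

For a fixed point `z` the contributions of the scales `n, n - 1, …, 0` are independent standard
Gaussian variables (`IsWeightFamily.hasLaw_scaleSum`), so that `mbrw n b z` is the endpoint of a
Gaussian walk of `n + 1` steps. Let `slope n = A n / (n + 1)`, and record this walk by its distance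
below the line `i ↦ 1 + slope n * i`. A path has weight zero unless it stays strictly below this
line and ends within distance one of it, which forces `A n ≤ mbrw n b z`. Instead of the indicator
of this event, the weight `pathWeight` is the product over the steps of the probabilities that a
Brownian bridge interpolating the step stays below the line. The `t`-step kernel of the weighted
walk is then the transition density of Brownian motion with drift killed at `0`, given exactly by
the reflection principle (`iterate_step_eq`, from `setIntegral_reflKernel_mul`). The usual
ballot estimates become elementary bounds on this density (`le_survival`, `survival_le`).

*First moment.* The expected weight of a point is of order
`exp (-(slope n) ^ 2 (n + 1) / 2) / (n + 1) ^ (3 / 2)`, and the logarithmic correction in `A n` is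
such that this is of order `4 ^ (-n)` (`le_exp_slope`). There are `4 ^ (n - 1)` points.

*Second moment.* Let `z ≠ w` be points of the central box with `2 ^ (s - 1) ≤ |z - w| < 2 ^ s` in
the sup-norm. On the scales `k < s` they share no square, so their contributions are independent
there. On the coarser scales they are correlated but not equal. If `f` is the expected weight of
the last `s` steps as a function of the distance `y` below the line, the correlation of the two
weights is at most the expectation of the weights of the coarse parts times `f y * f y'`, and
`f y * f y' ≤ f y ^ 2 + f y' ^ 2` reduces this to the law of the coarse part of a single walk
(`pairWeight_le`). No comparison of the two coarse paths is needed. By `survival_le`, `f y` is at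
most a multiple of `y * exp (-(slope n) * y)`, which makes the integral over the height at the
branching scale converge (`iterate_step_survival_sq_le`). At most `4 ^ (s + 1)` points `w`
correspond to each `s`, and the sum over `s` is bounded by a multiple of `4 ^ (-n)`
(`exists_sum_pairBound_le`).

The Cauchy–Schwarz inequality (`sq_lintegral_le`) then bounds from below the probability that some
weight is nonzero.
-/

namespace MBRW

open Set
open scoped ENNReal

/-! ### Brownian motion killed at the origin and the weighted walk -/

/-- Completing the square: the product of two Gaussian densities in `y` is again a multiple of a
Gaussian density in `y`. -/
theorem gaussianPDFReal_mul_gaussianPDFReal (a b y : ℝ) {s t : ℝ≥0} (hs : s ≠ 0) (ht : t ≠ 0) :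
    gaussianPDFReal 0 s (a - y) * gaussianPDFReal 0 t (b - y) =
      gaussianPDFReal 0 (s + t) (a - b) *
        gaussianPDFReal ((a * t + b * s) / (s + t)) (s * t / (s + t)) y := by
  have hs' : (0 : ℝ) < s := by positivity
  have ht' : (0 : ℝ) < t := by positivity
  have h1 : (√(2 * Real.pi * s))⁻¹ * (√(2 * Real.pi * t))⁻¹ =
      (√(2 * Real.pi * (s + t)))⁻¹ * (√(2 * Real.pi * (s * t / (s + t))))⁻¹ := by
    rw [← mul_inv, ← mul_inv, ← Real.sqrt_mul (by positivity), ← Real.sqrt_mul (by positivity)]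
    congr 2
    field_simp
  have h2 : -(a - y - 0) ^ 2 / (2 * s) + -(b - y - 0) ^ 2 / (2 * t) =
      -(a - b - 0) ^ 2 / (2 * (s + t)) +
        -(y - (a * t + b * s) / (s + t)) ^ 2 / (2 * (s * t / (s + t))) := by
    field_simp
    ring
  simp only [gaussianPDFReal, NNReal.coe_add, NNReal.coe_div, NNReal.coe_mul]
  rw [mul_mul_mul_comm, ← Real.exp_add, h1, h2, Real.exp_add]
  ring

theorem integrable_gaussianPDFReal_mul (a b : ℝ) {s t : ℝ≥0} (hs : s ≠ 0) (ht : t ≠ 0) :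
    Integrable fun y => gaussianPDFReal 0 s (a - y) * gaussianPDFReal 0 t (b - y) := by
  simp_rw [gaussianPDFReal_mul_gaussianPDFReal a b _ hs ht]
  exact (integrable_gaussianPDFReal _ _).const_mul _

theorem integral_gaussianPDFReal_mul (a b : ℝ) {s t : ℝ≥0} (hs : s ≠ 0) (ht : t ≠ 0) :
    ∫ y, gaussianPDFReal 0 s (a - y) * gaussianPDFReal 0 t (b - y) =
      gaussianPDFReal 0 (s + t) (a - b) := by
  simp_rw [gaussianPDFReal_mul_gaussianPDFReal a b _ hs ht]
  rw [integral_const_mul, integral_gaussianPDFReal_eq_one, mul_one]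
  have : s + t ≠ 0 := by positivity
  positivity

theorem gaussianPDFReal_zero_neg (t : ℝ≥0) (x : ℝ) :
    gaussianPDFReal 0 t (-x) = gaussianPDFReal 0 t x := by
  simp [gaussianPDFReal]

/-- The transition density `φ_t (y - x) - φ_t (y + x)` at time `t` of Brownian motion on the
half-line `(0, ∞)`, killed at `0`. -/
noncomputable def reflKernel (t : ℝ≥0) (x y : ℝ) : ℝ :=
  gaussianPDFReal 0 t (x - y) - gaussianPDFReal 0 t (x + y)

theorem reflKernel_eq {t : ℝ≥0} (ht : t ≠ 0) (x y : ℝ) :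
    reflKernel t x y = gaussianPDFReal 0 t (x - y) * (1 - Real.exp (-(2 * x * y / t))) := by
  have ht' : (0 : ℝ) < t := by positivity
  have h : -(x + y - 0) ^ 2 / (2 * t) = -(x - y - 0) ^ 2 / (2 * t) + -(2 * x * y / t) := by
    field_simp
    ring
  simp only [reflKernel, gaussianPDFReal]
  rw [h, Real.exp_add]
  ring

theorem reflKernel_nonneg {t : ℝ≥0} (ht : t ≠ 0) {x y : ℝ} (hx : 0 ≤ x) (hy : 0 ≤ y) :
    0 ≤ reflKernel t x y := by
  rw [reflKernel_eq ht]
  refine mul_nonneg (gaussianPDFReal_nonneg _ _ _) ?_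
  rw [sub_nonneg, Real.exp_le_one_iff]
  have : 0 ≤ 2 * x * y / (t : ℝ) := by positivity
  linarith

theorem reflKernel_neg_left (t : ℝ≥0) (x y : ℝ) : reflKernel t (-x) y = -reflKernel t x y := by
  rw [reflKernel, reflKernel, ← gaussianPDFReal_zero_neg t (-x - y),
    ← gaussianPDFReal_zero_neg t (-x + y)]
  ring_nf

theorem reflKernel_neg_right (t : ℝ≥0) (x y : ℝ) : reflKernel t x (-y) = -reflKernel t x y := by
  simp [reflKernel, sub_eq_add_neg]

theorem measurable_reflKernel (t : ℝ≥0) : Measurable fun p : ℝ × ℝ => reflKernel t p.1 p.2 := by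
  have := measurable_gaussianPDFReal 0 t
  unfold reflKernel
  fun_prop

theorem reflKernel_mul_reflKernel (s t : ℝ≥0) (x y z : ℝ) :
    reflKernel s x y * reflKernel t y z =
      gaussianPDFReal 0 s (x - y) * gaussianPDFReal 0 t (z - y)
      - gaussianPDFReal 0 s (x - y) * gaussianPDFReal 0 t (-z - y)
      - gaussianPDFReal 0 s (-x - y) * gaussianPDFReal 0 t (z - y)
      + gaussianPDFReal 0 s (-x - y) * gaussianPDFReal 0 t (-z - y) := by
  rw [reflKernel, reflKernel, ← gaussianPDFReal_zero_neg s (x + y),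
    ← gaussianPDFReal_zero_neg t (y - z), ← gaussianPDFReal_zero_neg t (y + z)]
  ring_nf

theorem integrable_reflKernel_mul {s t : ℝ≥0} (hs : s ≠ 0) (ht : t ≠ 0) (x z : ℝ) :
    Integrable fun y => reflKernel s x y * reflKernel t y z := by
  simp_rw [reflKernel_mul_reflKernel]
  have := fun a b => integrable_gaussianPDFReal_mul a b hs ht
  exact (((this _ _).sub (this _ _)).sub (this _ _)).add (this _ _)

theorem integral_reflKernel_mul {s t : ℝ≥0} (hs : s ≠ 0) (ht : t ≠ 0) (x z : ℝ) :
    ∫ y, reflKernel s x y * reflKernel t y z = 2 * reflKernel (s + t) x z := by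
  have := fun a b => integrable_gaussianPDFReal_mul a b hs ht
  have key : ∀ f g h k : ℝ → ℝ, Integrable f → Integrable g → Integrable h → Integrable k →
      ∫ y, f y - g y - h y + k y = (∫ y, f y) - (∫ y, g y) - (∫ y, h y) + ∫ y, k y := by
    intro f g h k hf hg hh hk
    rw [integral_add (f := fun y => f y - g y - h y) ((hf.sub hg).sub hh) hk,
      integral_sub (f := fun y => f y - g y) (hf.sub hg) hh, integral_sub hf hg]
  simp_rw [reflKernel_mul_reflKernel]
  rw [key _ _ _ _ (this _ _) (this _ _) (this _ _) (this _ _)]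
  simp only [integral_gaussianPDFReal_mul _ _ hs ht]
  rw [reflKernel, ← gaussianPDFReal_zero_neg _ (-x - z), ← gaussianPDFReal_zero_neg _ (-x - -z)]
  ring_nf

/-- Chapman–Kolmogorov for the killed kernel. The integrand is even in the intermediate point, so
the integral over the half-line is half of a combination of four Gaussian convolutions. -/
theorem setIntegral_reflKernel_mul {s t : ℝ≥0} (hs : s ≠ 0) (ht : t ≠ 0) (x z : ℝ) :
    ∫ y in Ioi 0, reflKernel s x y * reflKernel t y z = reflKernel (s + t) x z := by
  have h := integral_comp_abs (f := fun y => reflKernel s x y * reflKernel t y z)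
  have h' : ∀ y, reflKernel s x |y| * reflKernel t |y| z =
      reflKernel s x y * reflKernel t y z := by
    intro y
    rcases abs_choice y with hy | hy <;> rw [hy]
    rw [reflKernel_neg_left, reflKernel_neg_right, neg_mul_neg]
  simp only [h', integral_reflKernel_mul hs ht] at h
  linarith

/-- The transition density of Brownian motion with drift `m`, killed at `0`. -/
noncomputable def killedKernel (m : ℝ) (t : ℕ) (x y : ℝ) : ℝ :=
  Real.exp (m * (y - x) - m ^ 2 * t / 2) * reflKernel t x y

theorem killedKernel_nonneg (m : ℝ) {t : ℕ} (ht : t ≠ 0) {x y : ℝ} (hx : 0 ≤ x) (hy : 0 ≤ y) :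
    0 ≤ killedKernel m t x y :=
  mul_nonneg (Real.exp_nonneg _) (reflKernel_nonneg (by exact_mod_cast ht) hx hy)

theorem measurable_killedKernel (m : ℝ) (t : ℕ) :
    Measurable fun p : ℝ × ℝ => killedKernel m t p.1 p.2 := by
  have := measurable_reflKernel t
  unfold killedKernel
  fun_prop

/-- The kernel at time one is the transition density of the Gaussian walk with drift times the
weight of the bridge. -/
theorem killedKernel_one (m x y : ℝ) :
    killedKernel m 1 x y =
      gaussianPDFReal (x + m) 1 y * (1 - Real.exp (-(2 * x * y))) := by
  rw [killedKernel, reflKernel_eq (by simp)]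
  have h : m * (y - x) - m ^ 2 * (1 : ℕ) / 2 + -(x - y - 0) ^ 2 / (2 * ((1 : ℝ≥0) : ℝ)) =
      -(y - (x + m)) ^ 2 / (2 * ((1 : ℝ≥0) : ℝ)) := by
    push_cast
    ring
  rw [gaussianPDFReal, gaussianPDFReal, ← h, Real.exp_add]
  simp only [Nat.cast_one, NNReal.coe_one, div_one]
  ring

theorem setLIntegral_killedKernel_mul (m : ℝ) {t : ℕ} (ht : t ≠ 0) {x z : ℝ} (hx : 0 < x)
    (hz : 0 < z) :
    ∫⁻ y in Ioi 0, ENNReal.ofReal (killedKernel m 1 x y) * ENNReal.ofReal (killedKernel m t y z) =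
      ENNReal.ofReal (killedKernel m (t + 1) x z) := by
  have ht' : (t : ℝ≥0) ≠ 0 := by exact_mod_cast ht
  have h : ∀ y ∈ Ioi (0 : ℝ), ENNReal.ofReal (killedKernel m 1 x y) *
      ENNReal.ofReal (killedKernel m t y z) = ENNReal.ofReal
        (Real.exp (m * (z - x) - m ^ 2 * (t + 1 : ℕ) / 2) *
          (reflKernel 1 x y * reflKernel t y z)) := by
    intro y hy
    rw [← ENNReal.ofReal_mul (killedKernel_nonneg m one_ne_zero hx.le (le_of_lt hy)),
      killedKernel, killedKernel, mul_mul_mul_comm, ← Real.exp_add]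
    congr 3
    · push_cast
      ring_nf
    · simp
  rw [setLIntegral_congr_fun measurableSet_Ioi h, ← ofReal_integral_eq_lintegral_ofReal,
    integral_const_mul, setIntegral_reflKernel_mul one_ne_zero ht', killedKernel]
  · push_cast
    rw [add_comm (1 : ℝ≥0)]
  · exact ((integrable_reflKernel_mul one_ne_zero ht' x z).const_mul _).integrableOn
  · refine (ae_restrict_iff' measurableSet_Ioi).2 (ae_of_all _ fun y hy => ?_)
    exact mul_nonneg (Real.exp_nonneg _) (mul_nonneg
      (reflKernel_nonneg one_ne_zero hx.le (le_of_lt hy))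
      (reflKernel_nonneg ht' (le_of_lt hy) hz.le))

/-- The probability that a Brownian bridge of unit length from `x` to `y` stays positive. -/
noncomputable def bridgeWeight (x y : ℝ) : ℝ≥0∞ :=
  if 0 < x ∧ 0 < y then ENNReal.ofReal (1 - Real.exp (-(2 * x * y))) else 0

theorem bridgeWeight_le_one (x y : ℝ) : bridgeWeight x y ≤ 1 := by
  unfold bridgeWeight
  split_ifs
  · exact ENNReal.ofReal_le_one.2 (by linarith [Real.exp_nonneg (-(2 * x * y))])
  · exact zero_le

theorem measurable_bridgeWeight : Measurable fun p : ℝ × ℝ => bridgeWeight p.1 p.2 := by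
  unfold bridgeWeight
  refine Measurable.ite ?_ (by fun_prop) measurable_const
  exact (measurableSet_lt measurable_const measurable_fst).inter
    (measurableSet_lt measurable_const measurable_snd)

/-- One step of the walk `x ↦ x + m - ξ`, with `ξ` standard Gaussian, weighted by the probability
that the interpolating Brownian bridge stays positive. -/
noncomputable def step (m : ℝ) (g : ℝ → ℝ≥0∞) (x : ℝ) : ℝ≥0∞ :=
  ∫⁻ ξ, bridgeWeight x (x + m - ξ) * g (x + m - ξ) ∂gaussianReal 0 1

theorem measurable_step (m : ℝ) {g : ℝ → ℝ≥0∞} (hg : Measurable g) : Measurable (step m g) := by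
  refine Measurable.lintegral_prod_right
    (f := fun x ξ : ℝ => bridgeWeight x (x + m - ξ) * g (x + m - ξ)) ?_
  have h1 : Measurable fun p : ℝ × ℝ => bridgeWeight p.1 (p.1 + m - p.2) :=
    measurable_bridgeWeight.comp (f := fun p : ℝ × ℝ => (p.1, p.1 + m - p.2)) (by fun_prop)
  exact h1.mul (hg.comp (by fun_prop))

theorem measurable_iterate_step (m : ℝ) (t : ℕ) {g : ℝ → ℝ≥0∞} (hg : Measurable g) :
    Measurable ((step m)^[t] g) := by
  induction t with
  | zero => exact hg
  | succ t ih => rw [Function.iterate_succ_apply']; exact measurable_step m ih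

theorem step_eq (m : ℝ) {g : ℝ → ℝ≥0∞} (hg : Measurable g) {x : ℝ} (hx : 0 < x) :
    step m g x = ∫⁻ y in Ioi 0, ENNReal.ofReal (killedKernel m 1 x y) * g y := by
  have hw : Measurable fun y => bridgeWeight x y :=
    measurable_bridgeWeight.comp (f := fun y : ℝ => (x, y)) (by fun_prop)
  have h1 : step m g x = ∫⁻ y, bridgeWeight x y * g y ∂gaussianReal (x + m) 1 := by
    have := gaussianReal_map_const_sub (μ := 0) (v := 1) (x + m)
    rw [sub_zero] at this
    rw [step, ← this,
      lintegral_map (f := fun y => bridgeWeight x y * g y) (hw.mul hg) (by fun_prop)]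
  rw [h1, gaussianReal_of_var_ne_zero _ one_ne_zero,
    lintegral_withDensity_eq_lintegral_mul (g := fun y => bridgeWeight x y * g y) _
      (measurable_gaussianPDF _ _) (hw.mul hg),
    ← lintegral_indicator measurableSet_Ioi]
  congr 1 with y
  by_cases hy : 0 < y
  · rw [indicator_of_mem (by exact hy), killedKernel_one,
      ENNReal.ofReal_mul (gaussianPDFReal_nonneg _ _ _)]
    simp [bridgeWeight, hx, hy, gaussianPDF, mul_assoc]
  · rw [indicator_of_notMem (by exact hy)]
    simp [bridgeWeight, hy]

/-- The bridge weights make the iterated kernels of the weighted walk explicit. -/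
theorem iterate_step_eq (m : ℝ) {g : ℝ → ℝ≥0∞} (hg : Measurable g) (t : ℕ) {x : ℝ} (hx : 0 < x) :
    (step m)^[t + 1] g x =
      ∫⁻ y in Ioi 0, ENNReal.ofReal (killedKernel m (t + 1) x y) * g y := by
  induction t generalizing x with
  | zero => exact step_eq m hg hx
  | succ t ih =>
    have hm := fun t => (measurable_killedKernel m t).ennreal_ofReal
    have hm1 : Measurable fun y => ENNReal.ofReal (killedKernel m 1 x y) :=
      (hm 1).comp (f := fun y : ℝ => (x, y)) (by fun_prop)
    rw [Function.iterate_succ_apply', step_eq m (measurable_iterate_step m _ hg) hx]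
    calc _ = ∫⁻ y in Ioi 0, ∫⁻ z in Ioi 0, ENNReal.ofReal (killedKernel m 1 x y) *
          (ENNReal.ofReal (killedKernel m (t + 1) y z) * g z) := by
          refine setLIntegral_congr_fun measurableSet_Ioi fun y hy => ?_
          simp only [ih hy]
          rw [lintegral_const_mul]
          exact ((hm (t + 1)).comp (f := fun z : ℝ => (y, z)) (by fun_prop)).mul hg
      _ = ∫⁻ z in Ioi 0, ∫⁻ y in Ioi 0, ENNReal.ofReal (killedKernel m 1 x y) *
          (ENNReal.ofReal (killedKernel m (t + 1) y z) * g z) := by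
          refine lintegral_lintegral_swap (Measurable.aemeasurable ?_)
          exact (hm1.comp measurable_fst).mul ((hm (t + 1)).mul (hg.comp measurable_snd))
      _ = _ := by
          refine setLIntegral_congr_fun measurableSet_Ioi fun z hz => ?_
          simp only [← mul_assoc]
          rw [lintegral_mul_const, setLIntegral_killedKernel_mul m t.succ_ne_zero hx hz]
          exact hm1.mul ((hm (t + 1)).comp (f := fun y : ℝ => (y, z)) (by fun_prop))

/-! ### Bounds on the survival weights -/

theorem gaussianPDFReal_le (t : ℝ≥0) (x : ℝ) :
    gaussianPDFReal 0 t x ≤ (√(2 * Real.pi * t))⁻¹ := by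
  rw [gaussianPDFReal]
  refine mul_le_of_le_one_right (by positivity) (Real.exp_le_one_iff.2 ?_)
  rw [neg_div, neg_nonpos]
  positivity

/-- The factors `x` and `y` come from `1 - exp (-u) ≤ u`. They play the role of the ballot
estimate. -/
theorem reflKernel_le {t : ℕ} (ht : t ≠ 0) {x y : ℝ} (hx : 0 ≤ x) (hy : 0 ≤ y) :
    reflKernel t x y ≤ x * y / (t * √t) := by
  have ht' : (0 : ℝ) < t := by positivity
  rw [reflKernel_eq (by exact_mod_cast ht)]
  have h1 : 1 - Real.exp (-(2 * x * y / t)) ≤ 2 * x * y / t := by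
    linarith [Real.add_one_le_exp (-(2 * x * y / t))]
  have h2 : gaussianPDFReal 0 t (x - y) ≤ (2 * √t)⁻¹ := by
    refine (gaussianPDFReal_le _ _).trans (inv_anti₀ (by positivity) ?_)
    rw [show (2 : ℝ) * √t = √(2 ^ 2 * t) by rw [Real.sqrt_mul (by positivity)]; simp]
    refine Real.sqrt_le_sqrt ?_
    have := Real.pi_gt_three
    simp only [NNReal.coe_natCast]
    nlinarith
  calc _ ≤ (2 * √t)⁻¹ * (2 * x * y / t) := by
        refine mul_le_mul h2 h1 ?_ (by positivity)
        rw [sub_nonneg, Real.exp_le_one_iff, neg_nonpos, NNReal.coe_natCast]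
        positivity
    _ = _ := by field_simp

theorem killedKernel_le (m : ℝ) {t : ℕ} (ht : t ≠ 0) {x y : ℝ} (hx : 0 ≤ x) (hy : 0 ≤ y) :
    killedKernel m t x y ≤ Real.exp (m * (y - x) - m ^ 2 * t / 2) * (x * y / (t * √t)) :=
  mul_le_mul_of_nonneg_left (reflKernel_le ht hx hy) (Real.exp_nonneg _)

/-- The terminal condition: the walk ends within distance one of the barrier. -/
noncomputable def terminal : ℝ → ℝ≥0∞ := (Ioc 0 1).indicator 1

theorem measurable_terminal : Measurable terminal :=
  measurable_one.indicator measurableSet_Ioc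

/-- The total weight of the walks of length `s` started at distance `x` below the barrier. -/
noncomputable def survival (m : ℝ) (s : ℕ) : ℝ → ℝ≥0∞ := (step m)^[s] terminal

theorem measurable_survival (m : ℝ) (s : ℕ) : Measurable (survival m s) :=
  measurable_iterate_step m s measurable_terminal

theorem survival_eq (m : ℝ) {s : ℕ} (hs : s ≠ 0) {x : ℝ} (hx : 0 < x) :
    survival m s x = ∫⁻ y in Ioc 0 1, ENNReal.ofReal (killedKernel m s x y) := by
  obtain ⟨s, rfl⟩ := Nat.exists_eq_succ_of_ne_zero hs
  rw [survival, Nat.succ_eq_add_one, iterate_step_eq m measurable_terminal s hx,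
    ← lintegral_indicator measurableSet_Ioi, ← lintegral_indicator measurableSet_Ioc]
  congr 1 with y
  simp only [terminal, indicator, mem_Ioi, mem_Ioc, Pi.one_apply]
  split_ifs <;> simp_all

/-- Upper ballot estimate. The factor `exp (-m x)` comes from the drift. -/
theorem survival_le {m : ℝ} (hm : 0 ≤ m) {s : ℕ} (hs : s ≠ 0) {x : ℝ} (hx : 0 < x) :
    survival m s x ≤
      ENNReal.ofReal (Real.exp (m - m * x - m ^ 2 * s / 2) * (x / (s * √s))) := by
  rw [survival_eq m hs hx]
  calc _ ≤ ∫⁻ y in Ioc (0 : ℝ) 1,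
        ENNReal.ofReal (Real.exp (m - m * x - m ^ 2 * s / 2) * (x / (s * √s))) := by
        refine setLIntegral_mono measurable_const fun y hy => ENNReal.ofReal_le_ofReal ?_
        refine (killedKernel_le m hs hx.le hy.1.le).trans ?_
        have h1 : m * y ≤ m := mul_le_of_le_one_right hm hy.2
        have h2 : x * y ≤ x := mul_le_of_le_one_right hx.le hy.2
        have h3 : 0 ≤ x * y := mul_nonneg hx.le hy.1.le
        gcongr
        linarith
    _ = _ := by simp

/-- Lower ballot estimate: the walk starts at distance one below the barrier, and the
contribution of the endpoints in `(1 / 2, 1]` suffices. -/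
theorem le_survival {m : ℝ} (hm : 0 ≤ m) (hm2 : m ≤ 2) {s : ℕ} (hs : s ≠ 0) :
    ENNReal.ofReal (Real.exp (-2) / 12 * (Real.exp (-(m ^ 2 * s / 2)) / (s * √s))) ≤
      survival m s 1 := by
  have hs' : (0 : ℝ) < s := by positivity
  have hs1 : (1 : ℝ) ≤ s := by exact_mod_cast Nat.one_le_iff_ne_zero.2 hs
  rw [survival_eq m hs one_pos]
  calc _ = ∫⁻ y in Ioc (1 / 2 : ℝ) 1,
        ENNReal.ofReal (Real.exp (-2) / 6 * (Real.exp (-(m ^ 2 * s / 2)) / (s * √s))) := by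
        rw [setLIntegral_const, Real.volume_Ioc, ← ENNReal.ofReal_mul (by positivity)]
        congr 1
        ring
    _ ≤ ∫⁻ y in Ioc (1 / 2 : ℝ) 1, ENNReal.ofReal (killedKernel m s 1 y) := by
        refine setLIntegral_mono' measurableSet_Ioc fun y hy => ENNReal.ofReal_le_ofReal ?_
        have hy1 := hy.1
        have hy2 := hy.2
        -- on this interval the drift costs a factor of at least `exp (-m / 2) ≥ exp (-1)`
        have h1 : Real.exp (-1) * Real.exp (-(m ^ 2 * s / 2)) ≤
            Real.exp (m * (y - 1) - m ^ 2 * s / 2) := by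
          rw [← Real.exp_add]
          refine Real.exp_le_exp.2 ?_
          nlinarith
        have h2 : Real.exp (-1) / (3 * √s) ≤ gaussianPDFReal 0 s (1 - y) := by
          rw [gaussianPDFReal, div_eq_inv_mul]
          simp only [NNReal.coe_natCast]
          have hsq : √(2 * Real.pi * s) ≤ 3 * √s := by
            rw [show (3 : ℝ) * √s = √(3 ^ 2 * s) by rw [Real.sqrt_mul (by positivity)]; simp]
            refine Real.sqrt_le_sqrt ?_
            have := Real.pi_lt_four
            nlinarith
          refine mul_le_mul (inv_anti₀ (by positivity) hsq) (Real.exp_le_exp.2 ?_)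
            (Real.exp_nonneg _) (by positivity)
          rw [le_div_iff₀ (by positivity)]
          nlinarith
        -- `1 - exp (-u) ≥ u / (1 + u)` at `u = 1 / s`
        have h3 : 1 / (2 * s) ≤ 1 - Real.exp (-(2 * 1 * y / s)) := by
          have h4 : Real.exp (-(2 * 1 * y / s)) ≤ Real.exp (-(1 / s)) := by
            refine Real.exp_le_exp.2 (neg_le_neg ?_)
            gcongr
            linarith
          have h5 : Real.exp (-(1 / s : ℝ)) ≤ 1 / (1 + 1 / s) := by
            rw [Real.exp_neg, ← one_div]
            refine one_div_le_one_div_of_le (by positivity) ?_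
            linarith [Real.add_one_le_exp (1 / s : ℝ)]
          have h6 : 1 / (2 * s) ≤ 1 - 1 / (1 + 1 / s : ℝ) := by
            have : 1 - 1 / (1 + 1 / s : ℝ) = 1 / (s + 1) := by
              field_simp
              ring
            rw [this]
            exact one_div_le_one_div_of_le (by positivity) (by linarith)
          linarith
        rw [killedKernel, reflKernel_eq (by exact_mod_cast hs)]
        simp only [NNReal.coe_natCast]
        calc _ = (Real.exp (-1) * Real.exp (-(m ^ 2 * s / 2))) *
              (Real.exp (-1) / (3 * √s) * (1 / (2 * s))) := by
              rw [show (-2 : ℝ) = -1 + -1 by norm_num, Real.exp_add]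
              field_simp
              norm_num
          _ ≤ _ := by
              gcongr
              exact gaussianPDFReal_nonneg _ _ _
    _ ≤ _ := lintegral_mono_set (Ioc_subset_Ioc_left (by norm_num))

theorem lintegral_pow_three_mul_exp {m : ℝ} (hm : 0 < m) :
    ∫⁻ y in Ioi 0, ENNReal.ofReal (y ^ 3 * Real.exp (-(m * y))) = ENNReal.ofReal (6 / m ^ 4) := by
  have h := Real.integral_rpow_mul_exp_neg_mul_Ioi (a := 4) (by norm_num) hm
  have hG : Real.Gamma 4 = 6 := by
    rw [show (4 : ℝ) = (3 : ℕ) + 1 by norm_num, Real.Gamma_nat_eq_factorial]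
    norm_num [Nat.factorial]
  have h' : ∫ y in Ioi 0, y ^ 3 * Real.exp (-(m * y)) = 6 / m ^ 4 := by
    rw [hG] at h
    norm_num at h
    rw [h, div_eq_inv_mul]
  rw [← h', ofReal_integral_eq_lintegral_ofReal]
  · refine not_imp_comm.1 integral_undef ?_
    rw [h']
    positivity
  · refine (ae_restrict_iff' measurableSet_Ioi).2 (ae_of_all _ fun y hy => ?_)
    have : (0 : ℝ) < y := hy
    simp only [Pi.zero_apply]
    positivity

/-- Two walks sharing `t` steps and then evolving independently for `s` steps. The
factor `exp (-m y)` that survives at the branching height makes the integral over that height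
converge. -/
theorem iterate_step_survival_sq_le {m : ℝ} (hm : 0 < m) {s t : ℕ} (hs : s ≠ 0) (ht : t ≠ 0) :
    (step m)^[t] (fun y => survival m s y ^ 2) 1 ≤
      ENNReal.ofReal (Real.exp m * Real.exp (-(m ^ 2 * (t + 2 * s) / 2)) * (6 / m ^ 4) /
        ((t * √t) * (s * √s) ^ 2)) := by
  obtain ⟨t, rfl⟩ := Nat.exists_eq_succ_of_ne_zero ht
  rw [Nat.succ_eq_add_one, iterate_step_eq m ((measurable_survival m s).pow_const 2) t one_pos]
  set C := Real.exp m * Real.exp (-(m ^ 2 * ((t + 1 : ℕ) + 2 * s) / 2)) /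
        (((t + 1 : ℕ) * √(t + 1 : ℕ)) * (s * √s) ^ 2) with hC
  have hC0 : 0 ≤ C := by positivity
  calc _ ≤ ∫⁻ y in Ioi (0 : ℝ), ENNReal.ofReal C *
        ENNReal.ofReal (y ^ 3 * Real.exp (-(m * y))) := by
        refine setLIntegral_mono' measurableSet_Ioi fun y hy => ?_
        have hy : 0 < y := hy
        calc _ ≤ ENNReal.ofReal (Real.exp (m * (y - 1) - m ^ 2 * (t + 1 : ℕ) / 2) *
                (1 * y / ((t + 1 : ℕ) * √(t + 1 : ℕ)))) *
              ENNReal.ofReal (Real.exp (m - m * y - m ^ 2 * s / 2) * (y / (s * √s))) ^ 2 := by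
              gcongr
              · exact killedKernel_le m t.succ_ne_zero zero_le_one hy.le
              · exact survival_le hm.le hs hy
          _ = _ := by
              rw [← ENNReal.ofReal_pow (by positivity), ← ENNReal.ofReal_mul (by positivity),
                ← ENNReal.ofReal_mul hC0]
              congr 1
              have h1 : Real.exp (m * (y - 1) - m ^ 2 * (t + 1 : ℕ) / 2) *
                  Real.exp (m - m * y - m ^ 2 * s / 2) ^ 2 =
                  Real.exp m * Real.exp (-(m ^ 2 * ((t + 1 : ℕ) + 2 * s) / 2)) *
                    Real.exp (-(m * y)) := by
                rw [← Real.exp_nat_mul, ← Real.exp_add, ← Real.exp_add, ← Real.exp_add]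
                congr 1
                push_cast
                ring
              calc _ = (Real.exp (m * (y - 1) - m ^ 2 * (t + 1 : ℕ) / 2) *
                  Real.exp (m - m * y - m ^ 2 * s / 2) ^ 2) *
                  ((1 * y / ((t + 1 : ℕ) * √(t + 1 : ℕ))) * (y / (s * √s)) ^ 2) := by ring
                _ = _ := by
                  rw [h1, hC]
                  ring
    _ = _ := by
        rw [lintegral_const_mul _ (by fun_prop), lintegral_pow_three_mul_exp hm,
          ← ENNReal.ofReal_mul hC0, hC]
        congr 1
        ring

/-! ### The slope of the barrier and the sum over branching scales -/

/-- The slope of the barrier: the height `A n` is reached after `n + 1` steps. -/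
noncomputable def slope (n : ℕ) : ℝ := A n / (n + 1)

theorem A_sq (n : ℕ) : A n ^ 2 = 4 * Real.log 2 * n ^ 2 - 3 * n * Real.log n +
    9 / (16 * Real.log 2) * Real.log n ^ 2 := by
  have h2 : 0 < Real.log 2 := Real.log_pos one_lt_two
  have hs : √(Real.log 2) ^ 2 = Real.log 2 := Real.sq_sqrt h2.le
  have hs0 : 0 < √(Real.log 2) := Real.sqrt_pos.2 h2
  rw [A]
  have h1 : (3 / (4 * √(Real.log 2))) ^ 2 = 9 / (16 * Real.log 2) := by
    rw [div_pow, mul_pow, hs]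
    norm_num
  have h3 : √(Real.log 2) * (3 / (4 * √(Real.log 2))) = 3 / 4 := by field_simp
  calc _ = 4 * √(Real.log 2) ^ 2 * n ^ 2 -
        4 * (√(Real.log 2) * (3 / (4 * √(Real.log 2)))) * (n * Real.log n) +
        (3 / (4 * √(Real.log 2))) ^ 2 * Real.log n ^ 2 := by ring
    _ = _ := by rw [hs, h1, h3]; ring

theorem slope_le (n : ℕ) : slope n ≤ 2 := by
  have hs : √(Real.log 2) ≤ 1 := Real.sqrt_le_one.2 (by linarith [Real.log_two_lt_d9])
  have hL : 0 ≤ Real.log n := Real.log_natCast_nonneg n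
  rw [slope, div_le_iff₀ (by positivity), A]
  have h1 : 0 ≤ 3 / (4 * √(Real.log 2)) * Real.log n := by positivity
  nlinarith [Nat.cast_nonneg (α := ℝ) n]

theorem le_slope {n : ℕ} (hn : 1 ≤ n) : 1 / 4 ≤ slope n := by
  have hs : 4 / 5 ≤ √(Real.log 2) := Real.le_sqrt_of_sq_le (by linarith [Real.log_two_gt_d9])
  have hn1 : (1 : ℝ) ≤ n := by exact_mod_cast hn
  have hL : 0 ≤ Real.log n := Real.log_natCast_nonneg n
  have hL' : Real.log n ≤ n - 1 := Real.log_le_sub_one_of_pos (by linarith)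
  rw [slope, le_div_iff₀ (by positivity), A]
  have h1 : 3 / (4 * √(Real.log 2)) ≤ 15 / 16 := by
    rw [div_le_iff₀ (by positivity)]
    linarith
  have h2 : 3 / (4 * √(Real.log 2)) * Real.log n ≤ 15 / 16 * (n - 1) := by gcongr
  nlinarith

theorem mul_sqrt_eq_exp {x : ℝ} (hx : 0 < x) : x * √x = Real.exp (3 / 2 * Real.log x) := by
  have h : √x = Real.exp (Real.log x / 2) := by
    rw [← Real.log_sqrt hx.le, Real.exp_log (Real.sqrt_pos.2 hx)]
  rw [h]
  nth_rw 1 [← Real.exp_log hx]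
  rw [← Real.exp_add]
  ring_nf

theorem four_pow_eq_exp (s : ℕ) : (4 : ℝ) ^ s = Real.exp (2 * Real.log 2 * s) := by
  rw [show 2 * Real.log 2 * s = s * Real.log (2 ^ 2) by rw [Real.log_pow]; push_cast; ring,
    Real.exp_nat_mul, Real.exp_log (by norm_num)]
  norm_num

/-- The factor `(n + 1) ^ (3 / 2)`, produced by the logarithmic term of `A n`, compensates the
one lost in `le_survival`. -/
theorem le_exp_slope {n : ℕ} (hn : 1 ≤ n) :
    Real.exp (-6) * (((n + 1 : ℕ) : ℝ) * √(n + 1 : ℕ)) / 4 ^ n ≤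
      Real.exp (-(slope n ^ 2 * (n + 1 : ℕ) / 2)) := by
  have hn1 : (1 : ℝ) ≤ n := by exact_mod_cast hn
  have hL : 0 ≤ Real.log n := Real.log_natCast_nonneg n
  have hLn : Real.log n ≤ n := Real.log_le_self (by positivity)
  have hLs : Real.log n ^ 2 ≤ 4 * n := by
    have h1 : Real.log n ≤ 2 * √n := by
      have := Real.log_le_self (Real.sqrt_nonneg (n : ℝ))
      rw [Real.log_sqrt (by positivity)] at this
      linarith
    calc Real.log n ^ 2 ≤ (2 * √n) ^ 2 := by gcongr
      _ = _ := by rw [mul_pow, Real.sq_sqrt (by positivity)]; norm_num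
  have hl2 := Real.log_two_gt_d9
  have hl2' := Real.log_two_lt_d9
  -- the coefficient of `(log n) ^ 2` is at most one, since `9 / 16 < log 2`
  have hκ : 9 / (16 * Real.log 2) * Real.log n ^ 2 ≤ Real.log n ^ 2 := by
    refine mul_le_of_le_one_left (sq_nonneg _) ?_
    rw [div_le_one (by positivity)]
    linarith
  have hN : Real.log (n + 1) ≤ Real.log n + 1 := by
    calc Real.log (n + 1) ≤ Real.log (n * 2) := Real.log_le_log (by positivity) (by linarith)
      _ = Real.log n + Real.log 2 := Real.log_mul (by positivity) (by norm_num)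
      _ ≤ _ := by linarith
  push_cast
  rw [mul_sqrt_eq_exp (by positivity), four_pow_eq_exp, ← Real.exp_add, ← Real.exp_sub]
  refine Real.exp_le_exp.2 ?_
  have h1 : slope n ^ 2 * (n + 1) / 2 = A n ^ 2 / (2 * (n + 1)) := by
    rw [slope]
    field_simp
  -- uses `3 log n + (log n) ^ 2 ≤ 7 n`
  have h2 : A n ^ 2 / (2 * (n + 1)) ≤ 2 * Real.log 2 * n - 3 / 2 * Real.log n + 4 := by
    rw [div_le_iff₀ (by positivity), A_sq]
    nlinarith
  rw [h1]
  linarith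

/-- The same order of magnitude as in `le_exp_slope`, from above and at every intermediate step,
where only `s ^ (3 / 2)` is lost. -/
theorem exp_slope_le {n s : ℕ} (hs : 1 ≤ s) (hsn : s ≤ n + 1) :
    Real.exp (-(slope n ^ 2 * s / 2)) ≤ Real.exp 6 * (s * √s) / 4 ^ s := by
  have hs1 : (1 : ℝ) ≤ s := by exact_mod_cast hs
  have hsN : (s : ℝ) ≤ n + 1 := by exact_mod_cast hsn
  have hl2 := Real.log_two_gt_d9
  have hl2' := Real.log_two_lt_d9
  rw [mul_sqrt_eq_exp (by positivity), four_pow_eq_exp, ← Real.exp_add, ← Real.exp_sub]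
  refine Real.exp_le_exp.2 ?_
  set N : ℝ := n + 1 with hNdef
  have hN0 : 0 < N := by positivity
  have hls : 0 ≤ Real.log s := Real.log_nonneg hs1
  have hlN : 0 ≤ Real.log N := Real.log_nonneg (by linarith)
  have hln : n * Real.log n ≤ N * Real.log N := by
    rcases Nat.eq_zero_or_pos n with h0 | h0
    · simp [h0, hNdef]
    · have : (0 : ℝ) < n := by exact_mod_cast h0
      have h1 : Real.log n ≤ Real.log N := Real.log_le_log this (by linarith)
      exact mul_le_mul (by linarith) h1 (Real.log_natCast_nonneg n) hN0.le
  -- `(s / N) log N = (s / N) log (N / s) + (s / N) log s ≤ 1 + log s`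
  have h1 : s / N * Real.log N ≤ 1 + Real.log s := by
    have h2 : Real.log N = Real.log (N / s) + Real.log s := by
      rw [← Real.log_mul (by positivity) (by positivity)]
      congr 1
      field_simp
    have h3 : s / N * Real.log (N / s) ≤ s / N * (N / s) := by
      gcongr
      exact Real.log_le_self (by positivity)
    have h4 : s / N * (N / s) = 1 := by field_simp
    have h5 : s / N * Real.log s ≤ Real.log s :=
      mul_le_of_le_one_left hls ((div_le_one hN0).2 hsN)
    rw [h2, mul_add]
    linarith
  -- `n ^ 2 ≥ N ^ 2 - 2 N` in the formula for `A n ^ 2`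
  have h6 : 4 * Real.log 2 * N ^ 2 - 8 * Real.log 2 * N - 3 * (N * Real.log N) ≤ A n ^ 2 := by
    rw [A_sq]
    have : 0 ≤ 9 / (16 * Real.log 2) * Real.log n ^ 2 := by positivity
    have hn : (n : ℝ) = N - 1 := by linarith
    nlinarith [hln, congrArg (· ^ 2) hn]
  have h7 : s / (2 * N ^ 2) * (4 * Real.log 2 * N ^ 2 - 8 * Real.log 2 * N -
      3 * (N * Real.log N)) ≤ slope n ^ 2 * s / 2 := by
    calc _ ≤ s / (2 * N ^ 2) * A n ^ 2 := by gcongr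
      _ = _ := by
        rw [slope, ← hNdef]
        field_simp
  have h8 : s / (2 * N ^ 2) * (4 * Real.log 2 * N ^ 2 - 8 * Real.log 2 * N -
      3 * (N * Real.log N)) = 2 * Real.log 2 * s - 4 * Real.log 2 * (s / N) -
        3 / 2 * (s / N * Real.log N) := by
    field_simp
    ring
  have h9 : s / N ≤ 1 := (div_le_one hN0).2 hsN
  nlinarith

/-- The bound, up to a factor two, for the correlation of the weights of two points that are
independent on the finest `s` scales: the bound `survival_le` for a single point if `s = 0`, that of
`iterate_step_survival_sq_le` otherwise. -/
noncomputable def pairBound (n s : ℕ) : ℝ :=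
  if s = 0 then Real.exp (-(slope n ^ 2 * (n + 1 : ℕ) / 2)) / ((n + 1 : ℕ) * √(n + 1 : ℕ)) else
    Real.exp (slope n) * Real.exp (-(slope n ^ 2 * ((n + 1 - s : ℕ) + 2 * s) / 2)) *
      (6 / slope n ^ 4) / (((n + 1 - s : ℕ) * √(n + 1 - s : ℕ)) * (s * √s) ^ 2)

theorem pairBound_nonneg (n s : ℕ) : 0 ≤ pairBound n s := by
  unfold pairBound
  split_ifs <;> positivity

theorem pairBound_zero_le (n : ℕ) : pairBound n 0 ≤ Real.exp 6 / 4 ^ n := by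
  rw [pairBound, if_pos rfl, div_le_iff₀ (by positivity)]
  refine (exp_slope_le (by omega) le_rfl).trans ?_
  rw [pow_succ, div_mul_eq_mul_div]
  gcongr
  linarith [show (0 : ℝ) < 4 ^ n by positivity]

/-- The larger of `s` and `t` is comparable to `s + t`. -/
theorem split_inv_le {s t : ℝ} (hs : 0 < s) (ht : 0 < t) :
    ((s + t) * √(s + t)) / ((t * √t) * (s * √s)) ≤ 4 * (1 / (s * √s) + 1 / (t * √t)) := by
  wlog h : t ≤ s generalizing s t
  · have := this ht hs (le_of_not_ge h)
    rw [add_comm t s, add_comm (1 / (t * √t)), mul_comm (s * √s)] at this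
    exact this
  have h1 : (s + t) * √(s + t) ≤ 4 * (s * √s) := by
    have h2 : √(s + t) ≤ 2 * √s := by
      rw [show (2 : ℝ) * √s = √(2 ^ 2 * s) by rw [Real.sqrt_mul (by positivity)]; simp]
      exact Real.sqrt_le_sqrt (by linarith)
    calc _ ≤ (2 * s) * (2 * √s) := by gcongr; linarith
      _ = _ := by ring
  calc _ ≤ 4 * (s * √s) / ((t * √t) * (s * √s)) := by gcongr
    _ = 4 * (1 / (t * √t)) := by field_simp
    _ ≤ _ := by
      have : 0 ≤ 1 / (s * √s) := by positivity
      linarith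

/-- The total contribution of at most `4 ^ (s + 1)` points, each contributing `pairBound n s`. -/
theorem pairBound_le {n s : ℕ} (hn : 1 ≤ n) (hs : 1 ≤ s) (hsn : s ≤ n) :
    4 ^ (s + 1) * pairBound n s ≤ 6144 * Real.exp 14 / 4 ^ n *
      (1 / (s * √s) + 1 / ((n + 1 - s : ℕ) * √(n + 1 - s : ℕ))) := by
  have hm := le_slope hn
  have hm2 := slope_le n
  obtain ⟨t, ht⟩ : ∃ t, t = n + 1 - s := ⟨_, rfl⟩
  have ht1 : 1 ≤ t := by omega
  have hs1 : (1 : ℝ) ≤ s := by exact_mod_cast hs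
  have ht1' : (1 : ℝ) ≤ t := by exact_mod_cast ht1
  have hst : ((n + 1 : ℕ) : ℝ) = s + t := by exact_mod_cast (by omega : n + 1 = s + t)
  rw [pairBound, if_neg (by omega), ← ht]
  have e1 : Real.exp (-(slope n ^ 2 * (t + 2 * s) / 2)) ≤
      (Real.exp 6 * ((s + t) * √(s + t)) / 4 ^ (n + 1)) * (Real.exp 6 * (s * √s) / 4 ^ s) := by
    have h1 := exp_slope_le (n := n) (s := n + 1) (by omega) le_rfl
    have h2 := exp_slope_le (n := n) hs (by omega)
    rw [hst] at h1
    calc _ = Real.exp (-(slope n ^ 2 * (s + t) / 2)) * Real.exp (-(slope n ^ 2 * s / 2)) := by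
          rw [← Real.exp_add]
          congr 1
          ring
      _ ≤ _ := by gcongr
  have e2 : 6 / slope n ^ 4 ≤ 1536 := by
    rw [div_le_iff₀ (by positivity)]
    calc (6 : ℝ) = 1536 * (1 / 4) ^ 4 := by norm_num
      _ ≤ _ := by gcongr
  have e3 : Real.exp (slope n) ≤ Real.exp 2 := Real.exp_le_exp.2 hm2
  calc _ ≤ 4 ^ (s + 1) * (Real.exp 2 * ((Real.exp 6 * ((s + t) * √(s + t)) / 4 ^ (n + 1)) *
        (Real.exp 6 * (s * √s) / 4 ^ s)) * 1536 / ((t * √t) * (s * √s) ^ 2)) := by gcongr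
    _ = 1536 * Real.exp 14 / 4 ^ n * (((s + t) * √(s + t)) / ((t * √t) * (s * √s))) := by
      rw [show (14 : ℝ) = 2 + 6 + 6 by norm_num, Real.exp_add, Real.exp_add, pow_succ, pow_succ]
      field_simp
    _ ≤ 1536 * Real.exp 14 / 4 ^ n * (4 * (1 / (s * √s) + 1 / (t * √t))) := by
      gcongr
      exact split_inv_le (by positivity) (by positivity)
    _ = _ := by ring

theorem summable_one_div_mul_sqrt : Summable fun s : ℕ => 1 / ((s : ℝ) * √s) := by
  refine (Real.summable_one_div_nat_rpow.2 (by norm_num : (1 : ℝ) < 3 / 2)).congr fun s => ?_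
  rcases Nat.eq_zero_or_pos s with h | h
  -- both sides are zero at `s = 0` by the convention for division by zero
  · simp [h]
  · have : (0 : ℝ) < s := by exact_mod_cast h
    rw [mul_sqrt_eq_exp this, Real.rpow_def_of_pos this, mul_comm]

theorem exists_sum_pairBound_le :
    ∃ C : ℝ, 0 < C ∧ ∀ n : ℕ, 1 ≤ n →
      ∑ s ∈ Finset.range n, 4 ^ (s + 1) * pairBound n s ≤ C / 4 ^ n := by
  set f : ℕ → ℝ := fun s => 1 / ((s : ℝ) * √s) with hf
  have hf0 : ∀ s, 0 ≤ f s := fun s => by positivity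
  set S := ∑' s, f s
  have hS : 0 ≤ S := tsum_nonneg hf0
  refine ⟨4 * Real.exp 6 + 6144 * Real.exp 14 * (S + S), by positivity, fun n hn => ?_⟩
  have hle : ∀ s : Finset ℕ, ∑ i ∈ s, f i ≤ S := fun s =>
    summable_one_div_mul_sqrt.sum_le_tsum s fun i _ => hf0 i
  have h1 : ∀ s ∈ Finset.range n, 4 ^ (s + 1) * pairBound n s ≤
      (if s = 0 then 4 * Real.exp 6 / 4 ^ n else 0) +
        6144 * Real.exp 14 / 4 ^ n * (f s + f (n + 1 - s)) := by
    intro s hs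
    have hs := Finset.mem_range.1 hs
    have h2 : 0 ≤ 6144 * Real.exp 14 / 4 ^ n * (f s + f (n + 1 - s)) :=
      mul_nonneg (by positivity) (add_nonneg (hf0 _) (hf0 _))
    split_ifs with h
    · subst h
      have := pairBound_zero_le n
      calc (4 : ℝ) ^ (0 + 1) * pairBound n 0 ≤ 4 * (Real.exp 6 / 4 ^ n) := by
            rw [zero_add, pow_one]; gcongr
        _ = 4 * Real.exp 6 / 4 ^ n := by ring
        _ ≤ _ := by linarith
    · rw [zero_add]
      exact pairBound_le hn (by omega) hs.le
  refine (Finset.sum_le_sum h1).trans ?_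
  rw [Finset.sum_add_distrib, ← Finset.mul_sum, Finset.sum_add_distrib, Finset.sum_ite_eq' _ 0,
    if_pos (Finset.mem_range.2 hn)]
  have h3 : ∑ s ∈ Finset.range n, f (n + 1 - s) ≤ S := by
    rw [← Finset.sum_image (f := f) (g := fun s => n + 1 - s)]
    · exact hle _
    · intro a ha b hb hab
      simp only [Finset.coe_range, mem_Iio] at ha hb hab
      omega
  calc _ ≤ 4 * Real.exp 6 / 4 ^ n + 6144 * Real.exp 14 / 4 ^ n * (S + S) := by
        gcongr
        exact hle _
    _ = _ := by ring

/-! ### Path weights and their correlations -/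

/-- The weight of a path with increments `x`, the coordinate `k` of `x` being the contribution of
scale `k`. The path runs from the coarsest scale to the finest one; `y` is the distance of its
starting point below the barrier. -/
noncomputable def pathWeight (m : ℝ) : (k : ℕ) → ℝ → (Fin k → ℝ) → ℝ≥0∞
  | 0, y, _ => terminal y
  | k + 1, y, x => bridgeWeight y (y + m - x (Fin.last k)) *
      pathWeight m k (y + m - x (Fin.last k)) fun i => x i.castSucc

theorem pathWeight_le_one (m : ℝ) (k : ℕ) (y : ℝ) (x : Fin k → ℝ) : pathWeight m k y x ≤ 1 := by
  induction k generalizing y with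
  | zero => exact indicator_le_self' (fun _ _ => zero_le_one) y
  | succ k ih => exact mul_le_one' (bridgeWeight_le_one _ _) (ih _ _)

theorem measurable_pathWeight (m : ℝ) (k : ℕ) :
    Measurable fun p : ℝ × (Fin k → ℝ) => pathWeight m k p.1 p.2 := by
  induction k with
  | zero => exact measurable_terminal.comp measurable_fst
  | succ k ih =>
    refine Measurable.mul ?_ ?_
    · exact measurable_bridgeWeight.comp
        (f := fun p : ℝ × (Fin (k + 1) → ℝ) => (p.1, p.1 + m - p.2 (Fin.last k))) (by fun_prop)
    · exact ih.comp (f := fun p : ℝ × (Fin (k + 1) → ℝ) =>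
        (p.1 + m - p.2 (Fin.last k), fun i => p.2 i.castSucc)) (by fun_prop)

/-- The path ends within distance one of the barrier. -/
theorem le_sum_of_pathWeight_ne_zero {m : ℝ} {k : ℕ} {y : ℝ} {x : Fin k → ℝ}
    (h : pathWeight m k y x ≠ 0) : y + m * k - 1 ≤ ∑ i, x i := by
  induction k generalizing y with
  | zero =>
    have : y ∈ Ioc (0 : ℝ) 1 := mem_of_indicator_ne_zero h
    simpa using this.2
  | succ k ih =>
    have h2 := ih (right_ne_zero_of_mul h)
    rw [Fin.sum_univ_castSucc]
    push_cast
    linarith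

theorem lintegral_pi_fin_succ {α : Type*} [MeasurableSpace α] {k : ℕ} (μ : ℕ → Measure α)
    [∀ i, SigmaFinite (μ i)] {h : α × (Fin k → α) → ℝ≥0∞} (hh : Measurable h) :
    ∫⁻ v, h (v (Fin.last k), fun i => v i.castSucc) ∂Measure.pi (fun i : Fin (k + 1) => μ i) =
      ∫⁻ a, ∫⁻ b, h (a, b) ∂Measure.pi (fun i : Fin k => μ i) ∂μ k := by
  have h1 := measurePreserving_piFinSuccAbove (fun i : Fin (k + 1) => μ i) (Fin.last k)
  have h2 := h1.lintegral_comp hh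
  rw [lintegral_prod _ hh.aemeasurable] at h2
  simpa [Fin.removeNth, Fin.init_def] using h2

theorem lintegral_pathWeight (m : ℝ) (k : ℕ) (y : ℝ) :
    ∫⁻ x, pathWeight m k y x ∂Measure.pi (fun _ : Fin k => gaussianReal 0 1) =
      survival m k y := by
  induction k generalizing y with
  | zero => simp [pathWeight, survival]
  | succ k ih =>
    have hm : Measurable fun p : ℝ × (Fin k → ℝ) => bridgeWeight y (y + m - p.1) *
        pathWeight m k (y + m - p.1) p.2 := by
      refine Measurable.mul ?_ ?_
      · exact measurable_bridgeWeight.comp (f := fun p : ℝ × (Fin k → ℝ) => (y, y + m - p.1))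
          (by fun_prop)
      · exact (measurable_pathWeight m k).comp
          (f := fun p : ℝ × (Fin k → ℝ) => (y + m - p.1, p.2)) (by fun_prop)
    have h1 := lintegral_pi_fin_succ (fun _ => gaussianReal 0 1) hm
    simp only [pathWeight]
    rw [h1, survival, Function.iterate_succ_apply', step]
    refine lintegral_congr fun a => ?_
    dsimp only
    rw [lintegral_const_mul, ih, survival]
    exact (measurable_pathWeight m k).comp
      (f := fun p : Fin k → ℝ => (y + m - a, p)) (by fun_prop)

/-- The correlation of the weights of two paths whose pairs of increments at scale `i` have
law `μ i`, independently over the scales. -/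
noncomputable def pairWeight (μ : ℕ → Measure (ℝ × ℝ)) (m : ℝ) (k : ℕ) (y z : ℝ) : ℝ≥0∞ :=
  ∫⁻ v, pathWeight m k y (fun i => (v i).1) * pathWeight m k z (fun i => (v i).2)
    ∂Measure.pi (fun i : Fin k => μ i)

theorem measurable_pathWeight_mul (m : ℝ) (k : ℕ) (y z : ℝ) :
    Measurable fun v : Fin k → ℝ × ℝ =>
      pathWeight m k y (fun i => (v i).1) * pathWeight m k z (fun i => (v i).2) := by
  refine Measurable.mul ?_ ?_
  · exact (measurable_pathWeight m k).comp
      (f := fun v : Fin k → ℝ × ℝ => (y, fun i => (v i).1)) (by fun_prop)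
  · exact (measurable_pathWeight m k).comp
      (f := fun v : Fin k → ℝ × ℝ => (z, fun i => (v i).2)) (by fun_prop)

theorem pairWeight_succ (μ : ℕ → Measure (ℝ × ℝ)) [∀ i, SigmaFinite (μ i)] (m : ℝ) (k : ℕ)
    (y z : ℝ) :
    pairWeight μ m (k + 1) y z =
      ∫⁻ a, bridgeWeight y (y + m - a.1) * bridgeWeight z (z + m - a.2) *
        pairWeight μ m k (y + m - a.1) (z + m - a.2) ∂μ k := by
  have hm : Measurable fun p : (ℝ × ℝ) × (Fin k → ℝ × ℝ) =>
      (bridgeWeight y (y + m - p.1.1) * pathWeight m k (y + m - p.1.1) (fun i => (p.2 i).1)) *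
      (bridgeWeight z (z + m - p.1.2) *
        pathWeight m k (z + m - p.1.2) (fun i => (p.2 i).2)) := by
    refine Measurable.mul (Measurable.mul ?_ ?_) (Measurable.mul ?_ ?_)
    · exact measurable_bridgeWeight.comp
        (f := fun p : (ℝ × ℝ) × (Fin k → ℝ × ℝ) => (y, y + m - p.1.1)) (by fun_prop)
    · exact (measurable_pathWeight m k).comp (f := fun p : (ℝ × ℝ) × (Fin k → ℝ × ℝ) =>
        (y + m - p.1.1, fun i => (p.2 i).1)) (by fun_prop)
    · exact measurable_bridgeWeight.comp
        (f := fun p : (ℝ × ℝ) × (Fin k → ℝ × ℝ) => (z, z + m - p.1.2)) (by fun_prop)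
    · exact (measurable_pathWeight m k).comp (f := fun p : (ℝ × ℝ) × (Fin k → ℝ × ℝ) =>
        (z + m - p.1.2, fun i => (p.2 i).2)) (by fun_prop)
  have h1 := lintegral_pi_fin_succ μ hm
  rw [pairWeight]
  simp only [pathWeight]
  rw [h1]
  refine lintegral_congr fun a => ?_
  rw [pairWeight, ← lintegral_const_mul _ (measurable_pathWeight_mul m k _ _)]
  refine lintegral_congr fun b => ?_
  ring

theorem pairWeight_of_prod {μ : ℕ → Measure (ℝ × ℝ)} [∀ i, SigmaFinite (μ i)] (m : ℝ) {k : ℕ}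
    (hμ : ∀ i < k, μ i = (gaussianReal 0 1).prod (gaussianReal 0 1)) (y z : ℝ) :
    pairWeight μ m k y z = survival m k y * survival m k z := by
  induction k generalizing y z with
  | zero => simp [pairWeight, pathWeight, survival]
  | succ k ih =>
    rw [pairWeight_succ, hμ k k.lt_succ_self]
    simp only [ih fun i hi => hμ i (hi.trans k.lt_succ_self)]
    have hm : ∀ y, Measurable fun a => bridgeWeight y (y + m - a) * survival m k (y + m - a) := by
      intro y
      refine Measurable.mul ?_ ((measurable_survival m k).comp (by fun_prop))
      exact measurable_bridgeWeight.comp (f := fun a : ℝ => (y, y + m - a)) (by fun_prop)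
    have hs : ∀ y, survival m (k + 1) y = step m (survival m k) y := fun y => by
      rw [survival, Function.iterate_succ_apply', survival]
    rw [hs, hs, step, step, ← lintegral_prod_mul (hm y).aemeasurable (hm z).aemeasurable]
    refine lintegral_congr fun a => ?_
    ring

/-- The paths need not coincide on the coarse scales: since `a b ≤ a ^ 2 + b ^ 2`, only their
marginal laws enter there. -/
theorem pairWeight_le {μ : ℕ → Measure (ℝ × ℝ)} [∀ i, SigmaFinite (μ i)] (m : ℝ) {s : ℕ} (t : ℕ)
    (hμ : ∀ i < s, μ i = (gaussianReal 0 1).prod (gaussianReal 0 1))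
    (h1 : ∀ i < s + t, (μ i).map Prod.fst = gaussianReal 0 1)
    (h2 : ∀ i < s + t, (μ i).map Prod.snd = gaussianReal 0 1) (y z : ℝ) :
    pairWeight μ m (s + t) y z ≤ (step m)^[t] (fun y => survival m s y ^ 2) y +
      (step m)^[t] (fun y => survival m s y ^ 2) z := by
  induction t generalizing y z with
  | zero =>
    rw [add_zero, pairWeight_of_prod m hμ]
    simp only [Function.iterate_zero, id]
    rcases le_total (survival m s y) (survival m s z) with h | h
    · exact (mul_le_mul_left h _).trans (by rw [← sq]; exact le_add_self)
    · exact (mul_le_mul_right h _).trans (by rw [← sq]; exact le_self_add)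
  | succ t ih =>
    set g := (step m)^[t] (fun y => survival m s y ^ 2) with hg
    have hgm : Measurable g :=
      measurable_iterate_step m t ((measurable_survival m s).pow_const 2)
    have hm : ∀ y, Measurable fun a => bridgeWeight y (y + m - a) * g (y + m - a) := by
      intro y
      refine Measurable.mul ?_ (hgm.comp (by fun_prop))
      exact measurable_bridgeWeight.comp (f := fun a : ℝ => (y, y + m - a)) (by fun_prop)
    rw [← add_assoc, pairWeight_succ, Function.iterate_succ_apply', ← hg, step, step]
    nth_rw 1 [← h1 (s + t) (by omega)]
    rw [← h2 (s + t) (by omega), lintegral_map (hm y) measurable_fst,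
      lintegral_map (hm z) measurable_snd,
      ← lintegral_add_left (f := fun a : ℝ × ℝ => bridgeWeight y (y + m - a.1) * g (y + m - a.1))
        ((hm y).comp measurable_fst)]
    refine lintegral_mono fun a => ?_
    have hi := ih (fun i hi => h1 i (by omega)) (fun i hi => h2 i (by omega)) (y + m - a.1)
      (z + m - a.2)
    calc _ ≤ bridgeWeight y (y + m - a.1) * bridgeWeight z (z + m - a.2) *
          (g (y + m - a.1) + g (z + m - a.2)) := by gcongr
      _ = bridgeWeight z (z + m - a.2) * (bridgeWeight y (y + m - a.1) * g (y + m - a.1)) +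
          bridgeWeight y (y + m - a.1) * (bridgeWeight z (z + m - a.2) * g (z + m - a.2)) := by
        ring
      _ ≤ _ := add_le_add (mul_le_of_le_one_left' (bridgeWeight_le_one _ _))
          (mul_le_of_le_one_left' (bridgeWeight_le_one _ _))

/-- The second moment method. -/
theorem sq_lintegral_le {Ω : Type*} [MeasurableSpace Ω] (P : Measure Ω) {Z : Ω → ℝ≥0∞}
    (hZ : AEMeasurable Z P) : (∫⁻ ω, Z ω ∂P) ^ 2 ≤ (∫⁻ ω, Z ω ^ 2 ∂P) * P {ω | Z ω ≠ 0} := by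
  have hs : NullMeasurableSet {ω | Z ω ≠ 0} P :=
    (hZ.nullMeasurableSet_preimage (measurableSet_singleton 0)).compl
  have h := ENNReal.lintegral_mul_le_Lp_mul_Lq P Real.HolderConjugate.two_two hZ
    ((aemeasurable_const (b := (1 : ℝ≥0∞))).indicator₀ hs)
  have h1 : Z * {ω | Z ω ≠ 0}.indicator (fun _ => (1 : ℝ≥0∞)) = Z := by
    ext ω
    by_cases hω : Z ω = 0 <;> simp [hω]
  have h2 : ∀ ω, ({ω | Z ω ≠ 0}.indicator (fun _ => (1 : ℝ≥0∞)) ω) ^ (2 : ℝ) =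
      {ω | Z ω ≠ 0}.indicator (fun _ => (1 : ℝ≥0∞)) ω := by
    intro ω
    by_cases hω : Z ω = 0 <;> simp [hω]
  simp only [h1, h2, lintegral_indicator_const₀ hs, one_mul] at h
  simp only [ENNReal.rpow_two] at h
  calc _ ≤ _ := pow_le_pow_left₀ zero_le h 2
    _ = _ := by
      rw [mul_pow, ← ENNReal.rpow_two, ← ENNReal.rpow_two, ← ENNReal.rpow_mul,
        ← ENNReal.rpow_mul]
      simp

/-! ### The scales of the modified branching random walk -/

section Independence

variable {Ω : Type*} [MeasurableSpace Ω] {P : Measure Ω}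

/-- Grouping an independent family indexed by pairs gives an independent family of families. -/
theorem iIndepFun_curry {ι κ : Type*} [Countable ι] [Countable κ] {X : ι → κ → Ω → ℝ}
    (hX : ∀ i j, AEMeasurable (X i j) P) (h : iIndepFun (fun p : ι × κ => X p.1 p.2) P) :
    iIndepFun (fun i ω => (fun j => X i j ω)) P := by
  have hP := h.isProbabilityMeasure
  have h' : iIndepFun (fun p : (_ : ι) × κ => X p.1 p.2) P :=
    h.precomp (g := Equiv.sigmaEquivProd ι κ) (Equiv.injective _)
  have hp : ∀ i j, IsProbabilityMeasure (P.map (X i j)) :=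
    fun i j => Measure.isProbabilityMeasure_map (hX i j)
  have h1 := (iIndepFun_iff_map_fun_eq_infinitePi_map₀'
    (X := fun p : (_ : ι) × κ => X p.1 p.2) (fun p => hX _ _)).1 h'
  have hm : ∀ i, AEMeasurable (fun ω j => X i j ω) P := fun i => aemeasurable_pi_iff.2 (hX i)
  rw [iIndepFun_iff_map_fun_eq_infinitePi_map₀' hm]
  have h2 : ∀ i, P.map (fun ω j => X i j ω) = Measure.infinitePi fun j => P.map (X i j) := by
    intro i
    refine (iIndepFun_iff_map_fun_eq_infinitePi_map₀' (hX i)).1 ?_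
    exact h.precomp (g := fun j => (i, j)) (Prod.mk_right_injective i)
  simp_rw [h2]
  rw [← Measure.infinitePi_map_piCurry (fun i j => P.map (X i j)), ← h1,
    AEMeasurable.map_map_of_aemeasurable (MeasurableEquiv.measurable _).aemeasurable
      (aemeasurable_pi_iff.2 fun p => hX _ _)]
  rfl

theorem hasLaw_sum_gaussianReal {ι : Type*} {f : ι → Ω → ℝ} {v : ℝ≥0}
    (hf : iIndepFun f P) (hl : ∀ i, HasLaw (f i) (gaussianReal 0 v) P) (T : Finset ι) :
    HasLaw (∑ i ∈ T, f i) (gaussianReal 0 (T.card * v)) P := by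
  classical
  have hP := hf.isProbabilityMeasure
  induction T using Finset.induction_on with
  | empty =>
    rw [Finset.card_empty, Nat.cast_zero, zero_mul, gaussianReal_zero_var]
    exact hasLaw_dirac_of_ae_eq (by rw [Finset.sum_empty]; rfl)
  | insert a T ha ih =>
    have hm : ∀ i, AEMeasurable (f i) P := fun i => (hl i).aemeasurable
    have h1 := hf.indepFun_finsetSum_of_notMem₀ hm ha
    have h2 := gaussianReal_add_gaussianReal_of_indepFun h1 ih.map_eq (hl a).map_eq
    rw [Finset.sum_insert ha, Finset.card_insert_of_notMem ha, add_comm]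
    refine ⟨ih.aemeasurable.add (hm a), ?_⟩
    rw [h2, add_zero]
    congr 1
    push_cast
    ring

end Independence

/-- Distinct squares of side `2 ^ k ≤ N` containing `z` remain distinct modulo `N`. -/
theorem torusRep_injOn {N k : ℕ} (h : 2 ^ k ≤ N) (z : ℤ × ℤ) :
    InjOn (torusRep N) (squaresAt k z) := by
  have h' : (2 : ℤ) ^ k ≤ N := by exact_mod_cast h
  intro c hc d hd hcd
  simp only [squaresAt, Finset.coe_product, Finset.coe_Ioc, mem_prod, mem_Ioc] at hc hd
  have key : ∀ a x y : ℤ, a - 2 ^ k < x → x ≤ a → a - 2 ^ k < y → y ≤ a →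
      x % N = y % N → x = y := by
    intro a x y h1 h2 h3 h4 h5
    have h6 : (N : ℤ) ∣ y - x := Int.ModEq.dvd h5
    have h7 := Int.eq_zero_of_abs_lt_dvd h6 (by rw [abs_lt]; constructor <;> linarith)
    linarith
  have h1 := congrArg Prod.fst hcd
  have h2 := congrArg Prod.snd hcd
  exact Prod.ext (key z.1 _ _ hc.1.1 hc.1.2 hd.1.1 hd.1.2 h1)
    (key z.2 _ _ hc.2.1 hc.2.2 hd.2.1 hd.2.2 h2)

/-- Two points at distance between `2 ^ k` and `N - 2 ^ k` share no square of side `2 ^ k`, even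
modulo `N`. -/
theorem torusRep_ne {N k : ℕ} {z w : ℤ × ℤ}
    (h : (2 : ℤ) ^ k ≤ |z.1 - w.1| ∧ |z.1 - w.1| + 2 ^ k ≤ N ∨
      (2 : ℤ) ^ k ≤ |z.2 - w.2| ∧ |z.2 - w.2| + 2 ^ k ≤ N) {c d : ℤ × ℤ}
    (hc : c ∈ squaresAt k z) (hd : d ∈ squaresAt k w) : torusRep N c ≠ torusRep N d := by
  simp only [squaresAt, Finset.mem_product, Finset.mem_Ioc] at hc hd
  have key : ∀ a b x y : ℤ, (2 : ℤ) ^ k ≤ |a - b| → |a - b| + 2 ^ k ≤ N → a - 2 ^ k < x →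
      x ≤ a → b - 2 ^ k < y → y ≤ b → x % N ≠ y % N := by
    intro a b x y h1 h2 h3 h4 h5 h6 h7
    have h8 : (N : ℤ) ∣ y - x := Int.ModEq.dvd h7
    have h9 := Int.eq_zero_of_abs_lt_dvd h8 (by
      rw [abs_lt]
      constructor <;> cases abs_cases (a - b) <;> linarith)
    cases abs_cases (a - b) <;> linarith
  intro hcd
  have h1 := congrArg Prod.fst hcd
  have h2 := congrArg Prod.snd hcd
  rcases h with h | h
  · exact key _ _ _ _ h.1 h.2 hc.1.1 hc.1.2 hd.1.1 hd.1.2 h1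
  · exact key _ _ _ _ h.1 h.2 hc.2.1 hc.2.2 hd.2.1 hd.2.2 h2

theorem card_squaresAt (k : ℕ) (z : ℤ × ℤ) : (squaresAt k z).card = 2 ^ (2 * k) := by
  rw [squaresAt, Finset.card_product, Int.card_Ioc, Int.card_Ioc, sub_sub_cancel, sub_sub_cancel,
    two_mul, pow_add]
  congr 1

/-- The contribution of the squares of side `2 ^ k` to the modified branching random walk. -/
noncomputable def scaleSum {Ω : Type*} (n : ℕ) (b : ℕ → ℤ × ℤ → Ω → ℝ) (k : ℕ) (z : ℤ × ℤ)
    (ω : Ω) : ℝ :=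
  ∑ c ∈ squaresAt k z, b k (torusRep (2 ^ n) c) ω

theorem mbrw_eq_sum {Ω : Type*} (n : ℕ) (b : ℕ → ℤ × ℤ → Ω → ℝ) (z : ℤ × ℤ) (ω : Ω) :
    mbrw n b z ω = ∑ i : Fin (n + 1), scaleSum n b i z ω :=
  (Fin.sum_univ_eq_sum_range (fun k => scaleSum n b k z ω) (n + 1)).symm

/-- The corners modulo `(2 ^ n ℤ)²` of the squares of side `2 ^ k` containing `z`. -/
noncomputable def corners (n k : ℕ) (z : ℤ × ℤ) : Finset {c : ℤ × ℤ // c ∈ box (2 ^ n)} :=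
  (squaresAt k z).image fun c => ⟨torusRep (2 ^ n) c, torusRep_mem (by positivity) c⟩

theorem card_corners {n k : ℕ} (hk : k ≤ n) (z : ℤ × ℤ) :
    (corners n k z).card = 2 ^ (2 * k) := by
  rw [corners, Finset.card_image_of_injOn, card_squaresAt]
  intro c hc d hd hcd
  exact torusRep_injOn (Nat.pow_le_pow_right two_pos hk) z hc hd (congrArg Subtype.val hcd)

theorem scaleSum_eq {Ω : Type*} {n k : ℕ} (hk : k ≤ n) (b : ℕ → ℤ × ℤ → Ω → ℝ) (z : ℤ × ℤ) :
    scaleSum n b k z = ∑ c ∈ corners n k z, b k c.1 := by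
  ext ω
  rw [corners, Finset.sum_image, Finset.sum_apply]
  · rfl
  · intro c hc d hd hcd
    exact torusRep_injOn (Nat.pow_le_pow_right two_pos hk) z hc hd (congrArg Subtype.val hcd)

/-- The weight of the path of partial sums of the modified branching random walk at `z`. -/
noncomputable def pointWeight {Ω : Type*} (n : ℕ) (b : ℕ → ℤ × ℤ → Ω → ℝ) (z : ℤ × ℤ) (ω : Ω) :
    ℝ≥0∞ :=
  pathWeight (slope n) (n + 1) 1 fun i => scaleSum n b i z ω

namespace IsWeightFamily

variable {Ω : Type*} [MeasurableSpace Ω] {P : Measure Ω} {n : ℕ} {b : ℕ → ℤ × ℤ → Ω → ℝ}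

theorem iIndepFun_scaleSum (hb : IsWeightFamily P (2 ^ n) b) (z w : ℤ × ℤ) :
    iIndepFun (fun k ω => (scaleSum n b k z ω, scaleSum n b k w ω)) P := by
  have h := iIndepFun_curry (X := fun k (c : {c : ℤ × ℤ // c ∈ box (2 ^ n)}) => b k c.1)
    (fun k c => (hb.hasLaw k c.1 c.2).aemeasurable) hb.indep
  have hN : 0 < 2 ^ n := by positivity
  exact h.comp (fun k (g : {c : ℤ × ℤ // c ∈ box (2 ^ n)} → ℝ) =>
    (∑ c ∈ squaresAt k z, g ⟨torusRep (2 ^ n) c, torusRep_mem hN c⟩,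
      ∑ c ∈ squaresAt k w, g ⟨torusRep (2 ^ n) c, torusRep_mem hN c⟩)) (fun k => by fun_prop)

theorem iIndepFun_scale (hb : IsWeightFamily P (2 ^ n) b) (k : ℕ) :
    iIndepFun (fun c : {c : ℤ × ℤ // c ∈ box (2 ^ n)} => b k c.1) P :=
  hb.indep.precomp (g := fun c => (k, c)) (Prod.mk_right_injective k)

theorem hasLaw_scaleSum (hb : IsWeightFamily P (2 ^ n) b) {k : ℕ} (hk : k ≤ n) (z : ℤ × ℤ) :
    HasLaw (scaleSum n b k z) (gaussianReal 0 1) P := by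
  have h := hasLaw_sum_gaussianReal (hb.iIndepFun_scale k) (fun c => hb.hasLaw k c.1 c.2)
    (corners n k z)
  rw [card_corners hk, ← scaleSum_eq hk] at h
  convert h using 2
  push_cast
  rw [mul_inv_cancel₀ (by positivity)]

theorem indepFun_scaleSum (hb : IsWeightFamily P (2 ^ n) b) {k : ℕ} (hk : k ≤ n) {z w : ℤ × ℤ}
    (h : (2 : ℤ) ^ k ≤ |z.1 - w.1| ∧ |z.1 - w.1| + 2 ^ k ≤ (2 ^ n : ℕ) ∨
      (2 : ℤ) ^ k ≤ |z.2 - w.2| ∧ |z.2 - w.2| + 2 ^ k ≤ (2 ^ n : ℕ)) :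
    IndepFun (scaleSum n b k z) (scaleSum n b k w) P := by
  have hd : Disjoint (corners n k z) (corners n k w) := by
    rw [Finset.disjoint_left]
    intro c hc hc'
    obtain ⟨d, hd, rfl⟩ := Finset.mem_image.1 hc
    obtain ⟨e, he, hde⟩ := Finset.mem_image.1 hc'
    exact torusRep_ne h hd he (congrArg Subtype.val hde).symm
  have h1 := (hb.iIndepFun_scale k).indepFun_finset₀ _ _ hd
    (fun c => (hb.hasLaw k c.1 c.2).aemeasurable)
  have h2 := h1.comp (φ := fun g => ∑ c, g c) (ψ := fun g => ∑ c, g c) (by fun_prop) (by fun_prop)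
  rw [scaleSum_eq hk, scaleSum_eq hk]
  convert h2 using 1 <;> ext ω <;>
    simp only [Finset.sum_apply, Function.comp_apply] <;> exact (Finset.sum_coe_sort _ _).symm

theorem aemeasurable_pointWeight (hb : IsWeightFamily P (2 ^ n) b) (z : ℤ × ℤ) :
    AEMeasurable (pointWeight n b z) P := by
  have h1 : Measurable fun x : Fin (n + 1) → ℝ => pathWeight (slope n) (n + 1) 1 x :=
    (measurable_pathWeight (slope n) (n + 1)).comp
      (f := fun x : Fin (n + 1) → ℝ => ((1 : ℝ), x)) (by fun_prop)
  refine h1.comp_aemeasurable (aemeasurable_pi_iff.2 fun i => ?_)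
  exact (hb.hasLaw_scaleSum (Nat.lt_succ_iff.1 i.2) z).aemeasurable

theorem lintegral_pointWeight (hb : IsWeightFamily P (2 ^ n) b) (z : ℤ × ℤ) :
    ∫⁻ ω, pointWeight n b z ω ∂P = survival (slope n) (n + 1) 1 := by
  have h1 : iIndepFun (fun (i : Fin (n + 1)) ω => scaleSum n b i z ω) P :=
    ((hb.iIndepFun_scaleSum z z).comp (fun _ => Prod.fst) fun _ => measurable_fst).precomp
      (g := fun i : Fin (n + 1) => (i : ℕ)) Fin.val_injective
  have h2 : HasLaw (fun ω (i : Fin (n + 1)) => scaleSum n b i z ω)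
      (Measure.pi fun _ => gaussianReal 0 1) P :=
    h1.hasLaw_pi fun i => hb.hasLaw_scaleSum (Nat.lt_succ_iff.1 i.2) z
  rw [← lintegral_pathWeight (slope n) (n + 1) 1]
  refine h2.lintegral_comp (f := fun x => pathWeight (slope n) (n + 1) 1 x)
    (Measurable.aemeasurable ?_)
  exact (measurable_pathWeight (slope n) (n + 1)).comp
    (f := fun x : Fin (n + 1) → ℝ => ((1 : ℝ), x)) (by fun_prop)

theorem lintegral_pointWeight_mul (hb : IsWeightFamily P (2 ^ n) b) (z w : ℤ × ℤ) :
    ∫⁻ ω, pointWeight n b z ω * pointWeight n b w ω ∂P =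
      pairWeight (fun k => P.map fun ω => (scaleSum n b k z ω, scaleSum n b k w ω))
        (slope n) (n + 1) 1 1 := by
  have hm : ∀ i : Fin (n + 1),
      AEMeasurable (fun ω => (scaleSum n b i z ω, scaleSum n b i w ω)) P := fun i =>
    (hb.hasLaw_scaleSum (Nat.lt_succ_iff.1 i.2) z).aemeasurable.prodMk
      (hb.hasLaw_scaleSum (Nat.lt_succ_iff.1 i.2) w).aemeasurable
  have h1 := ((hb.iIndepFun_scaleSum z w).precomp (g := fun i : Fin (n + 1) => (i : ℕ))
    Fin.val_injective).map_fun_eq_pi_map hm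
  rw [pairWeight, ← h1, lintegral_map' (measurable_pathWeight_mul _ _ _ _).aemeasurable
    (aemeasurable_pi_iff.2 hm)]
  rfl

/-- The correlation of the weights of two points of the central box. -/
theorem lintegral_pointWeight_mul_le (hb : IsWeightFamily P (2 ^ n) b) (hn : 1 ≤ n)
    {z w : ℤ × ℤ} (h : max (z.1 - w.1).natAbs (z.2 - w.2).natAbs < 2 ^ (n - 1)) :
    ∫⁻ ω, pointWeight n b z ω * pointWeight n b w ω ∂P ≤ ENNReal.ofReal
      (2 * pairBound n (max (z.1 - w.1).natAbs (z.2 - w.2).natAbs).size) := by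
  have hP := hb.indep.isProbabilityMeasure
  have hm : 0 < slope n := by linarith [le_slope hn]
  set d := max (z.1 - w.1).natAbs (z.2 - w.2).natAbs with hd
  obtain ⟨s, hs⟩ : ∃ s, s = d.size := ⟨_, rfl⟩
  have hsn : s ≤ n - 1 := hs ▸ Nat.size_le.2 h
  rw [← hs]
  rcases Nat.eq_zero_or_pos s with h0 | h0
  · have hp := pairBound_nonneg n 0
    calc _ ≤ ∫⁻ ω, pointWeight n b z ω ∂P :=
          lintegral_mono fun ω => mul_le_of_le_one_right' (pathWeight_le_one _ _ _ _)
      _ = survival (slope n) (n + 1) 1 := hb.lintegral_pointWeight z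
      _ ≤ _ := survival_le hm.le n.succ_ne_zero one_pos
      _ = ENNReal.ofReal (pairBound n 0) := by
        congr 1
        rw [pairBound, if_pos rfl, mul_one, sub_self, zero_sub, mul_one_div]
      _ ≤ _ := by
        rw [h0]
        exact ENNReal.ofReal_le_ofReal (by linarith)
  · set V : ℕ → Ω → ℝ × ℝ := fun k ω => (scaleSum n b k z ω, scaleSum n b k w ω) with hV
    have hl := fun k (hk : k ≤ n) z => hb.hasLaw_scaleSum hk z
    have hVm : ∀ k ≤ n, AEMeasurable (V k) P := fun k hk =>
      (hl k hk z).aemeasurable.prodMk (hl k hk w).aemeasurable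
    have hfst : ∀ k ≤ n, (P.map (V k)).map Prod.fst = gaussianReal 0 1 := by
      intro k hk
      rw [AEMeasurable.map_map_of_aemeasurable measurable_fst.aemeasurable (hVm k hk)]
      exact (hl k hk z).map_eq
    have hsnd : ∀ k ≤ n, (P.map (V k)).map Prod.snd = gaussianReal 0 1 := by
      intro k hk
      rw [AEMeasurable.map_map_of_aemeasurable measurable_snd.aemeasurable (hVm k hk)]
      exact (hl k hk w).map_eq
    have hpr : ∀ k < s, P.map (V k) = (gaussianReal 0 1).prod (gaussianReal 0 1) := by
      intro k hk
      refine (IndepFun.hasLaw_prod (hl k (by omega) z) (hl k (by omega) w)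
        (hb.indepFun_scaleSum (by omega) ?_)).map_eq
      -- `d < 2 ^ (n - 1)` leaves room for a square of side `2 ^ k` on the other side of the torus
      have h1 : 2 ^ k ≤ d := Nat.lt_size.1 (hs ▸ hk)
      have h2 : 2 ^ n = 2 ^ (n - 1) + 2 ^ (n - 1) := by
        obtain ⟨m, rfl⟩ := Nat.exists_eq_add_of_le' hn
        rw [Nat.add_sub_cancel, pow_succ, mul_two]
      have h3 : 2 ^ k ≤ 2 ^ (n - 1) := Nat.pow_le_pow_right two_pos (by omega)
      zify at h1 h2 h3 h
      push_cast
      have hd' : (d : ℤ) = |z.1 - w.1| ∨ (d : ℤ) = |z.2 - w.2| := by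
        rw [hd]
        push_cast
        exact max_choice _ _
      rcases hd' with hd' | hd'
      · left
        constructor <;> linarith
      · right
        constructor <;> linarith
    have hst : n + 1 = s + (n + 1 - s) := by omega
    have h1 := pairWeight_le (μ := fun k => P.map (V k)) (slope n) (n + 1 - s) hpr
      (fun k hk => hfst k (by omega)) (fun k hk => hsnd k (by omega)) 1 1
    rw [← hst] at h1
    have h2 := iterate_step_survival_sq_le hm (s := s) (t := n + 1 - s) (by omega) (by omega)
    rw [hb.lintegral_pointWeight_mul]
    refine h1.trans ((add_le_add h2 h2).trans_eq ?_)
    rw [pairBound, if_neg (by omega), ← ENNReal.ofReal_add (by positivity) (by positivity),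
      ← two_mul]

end IsWeightFamily

/-! ### The second moment argument -/

theorem two_pow_div_two {n : ℕ} (hn : 1 ≤ n) : 2 ^ n / 2 = 2 ^ (n - 1) := by
  obtain ⟨m, rfl⟩ := Nat.exists_eq_add_of_le' hn
  rw [pow_succ]
  simp

theorem card_centralBox {n : ℕ} (hn : 1 ≤ n) : (centralBox (2 ^ n)).card = 4 ^ (n - 1) := by
  have h := two_pow_div_two hn
  rw [centralBox, Finset.card_image_of_injective _ (add_left_injective _), box,
    Finset.card_product, Int.card_Ico, sub_zero, Int.toNat_natCast, h, ← mul_pow]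
  norm_num

theorem dist_lt_of_mem_centralBox {n : ℕ} (hn : 1 ≤ n) {z w : ℤ × ℤ}
    (hz : z ∈ centralBox (2 ^ n)) (hw : w ∈ centralBox (2 ^ n)) :
    max (z.1 - w.1).natAbs (z.2 - w.2).natAbs < 2 ^ (n - 1) := by
  have h := two_pow_div_two hn
  obtain ⟨x, hx, rfl⟩ := Finset.mem_image.1 hz
  obtain ⟨y, hy, rfl⟩ := Finset.mem_image.1 hw
  simp only [box, Finset.mem_product, Finset.mem_Ico, h] at hx hy
  simp only [Prod.fst_add, Prod.snd_add]
  omega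

/-- There are at most `4 ^ (s + 1)` points at sup-distance less than `2 ^ s` from a given one. -/
theorem card_filter_size_le (V : Finset (ℤ × ℤ)) (z : ℤ × ℤ) (s : ℕ) :
    (V.filter fun w => (max (z.1 - w.1).natAbs (z.2 - w.2).natAbs).size = s).card ≤
      4 ^ (s + 1) := by
  have hsub : (V.filter fun w => (max (z.1 - w.1).natAbs (z.2 - w.2).natAbs).size = s) ⊆
      Finset.Ioc (z.1 - 2 ^ s) (z.1 + 2 ^ s) ×ˢ Finset.Ioc (z.2 - 2 ^ s) (z.2 + 2 ^ s) := by
    intro w hw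
    have h1 := Nat.size_le.1 (Finset.mem_filter.1 hw).2.le
    have h2 : ((2 ^ s : ℕ) : ℤ) = 2 ^ s := by push_cast; rfl
    simp only [Finset.mem_product, Finset.mem_Ioc]
    omega
  refine (Finset.card_le_card hsub).trans_eq ?_
  have h3 : ∀ a : ℤ, (a + 2 ^ s - (a - 2 ^ s)).toNat = 2 ^ (s + 1) := by
    intro a
    rw [show a + 2 ^ s - (a - 2 ^ s) = ((2 ^ (s + 1) : ℕ) : ℤ) by push_cast; ring,
      Int.toNat_natCast]
  rw [Finset.card_product, Int.card_Ioc, Int.card_Ioc, h3, h3, ← mul_pow]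
  norm_num

theorem sum_pairBound_le {n : ℕ} (hn : 1 ≤ n) {z : ℤ × ℤ} (hz : z ∈ centralBox (2 ^ n)) :
    ∑ w ∈ centralBox (2 ^ n), pairBound n (max (z.1 - w.1).natAbs (z.2 - w.2).natAbs).size ≤
      ∑ s ∈ Finset.range n, 4 ^ (s + 1) * pairBound n s := by
  have hmaps : ∀ w ∈ centralBox (2 ^ n),
      (max (z.1 - w.1).natAbs (z.2 - w.2).natAbs).size ∈ Finset.range n := by
    intro w hw
    have := Nat.size_le.2 (dist_lt_of_mem_centralBox hn hz hw)
    exact Finset.mem_range.2 (by omega)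
  rw [← Finset.sum_fiberwise_of_maps_to hmaps]
  refine Finset.sum_le_sum fun s _ => ?_
  calc _ = ∑ w ∈ (centralBox (2 ^ n)).filter
          fun w => (max (z.1 - w.1).natAbs (z.2 - w.2).natAbs).size = s, pairBound n s :=
        Finset.sum_congr rfl fun w hw => by rw [(Finset.mem_filter.1 hw).2]
    _ ≤ _ := by
        rw [Finset.sum_const, nsmul_eq_mul]
        refine mul_le_mul_of_nonneg_right ?_ (pairBound_nonneg n s)
        exact_mod_cast card_filter_size_le _ z s

theorem A_le_mbrw_of_pointWeight_ne_zero {Ω : Type*} {n : ℕ} {b : ℕ → ℤ × ℤ → Ω → ℝ} {z : ℤ × ℤ}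
    {ω : Ω} (h : pointWeight n b z ω ≠ 0) : A n ≤ mbrw n b z ω := by
  have h1 := le_sum_of_pathWeight_ne_zero h
  rw [mbrw_eq_sum]
  refine le_trans (le_of_eq ?_) h1
  rw [slope]
  push_cast
  field_simp
  ring

/-- The first moment is bounded below: `4 ^ (n - 1)` points, each of weight at least a multiple of
`4 ^ (-n)`. -/
theorem le_sum_survival {n : ℕ} (hn : 1 ≤ n) :
    ENNReal.ofReal (Real.exp (-8) / 48) ≤
      ∑ _z ∈ centralBox (2 ^ n), survival (slope n) (n + 1) 1 := by
  have hm : 0 ≤ slope n := by linarith [le_slope hn]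
  have h1 := le_survival hm (slope_le n) (s := n + 1) n.succ_ne_zero
  rw [Finset.sum_const, card_centralBox hn, nsmul_eq_mul]
  refine le_trans ?_ (mul_le_mul_right h1 _)
  rw [← ENNReal.ofReal_natCast, ← ENNReal.ofReal_mul (by positivity)]
  refine ENNReal.ofReal_le_ofReal ?_
  have h2 := le_exp_slope hn
  set R : ℝ := ((n + 1 : ℕ) : ℝ) * √(n + 1 : ℕ) with hR
  have hR0 : 0 < R := by positivity
  have h4 : (4 : ℝ) ^ n = 4 ^ (n - 1) * 4 := by
    rw [← pow_succ, Nat.sub_add_cancel hn]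
  calc Real.exp (-8) / 48 = (4 ^ (n - 1) : ℕ) *
        (Real.exp (-2) / 12 * (Real.exp (-6) * R / 4 ^ n / R)) := by
        rw [h4, show (-8 : ℝ) = -2 + -6 by norm_num, Real.exp_add]
        push_cast
        field_simp
        norm_num
    _ ≤ _ := by gcongr

theorem exists_le_measureReal_centralMax :
    ∃ δ : ℝ, 0 < δ ∧ ∀ (n : ℕ) (hn : 1 ≤ n) (Ω : Type*) [MeasurableSpace Ω] (P : Measure Ω)
      [IsProbabilityMeasure P] (b : ℕ → ℤ × ℤ → Ω → ℝ), IsWeightFamily P (2 ^ n) b →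
        δ ≤ P.real {ω | A n ≤ centralMax n hn b ω} := by
  obtain ⟨C, hC, hsum⟩ := exists_sum_pairBound_le
  refine ⟨(Real.exp (-8) / 48) ^ 2 / C, by positivity, ?_⟩
  intro n hn Ω _ P _ b hb
  set V := centralBox (2 ^ n) with hV
  set Z : Ω → ℝ≥0∞ := fun ω => ∑ z ∈ V, pointWeight n b z ω with hZ
  have hZm : AEMeasurable Z P :=
    Finset.aemeasurable_fun_sum _ fun z _ => hb.aemeasurable_pointWeight z
  have hfirst : ENNReal.ofReal (Real.exp (-8) / 48) ≤ ∫⁻ ω, Z ω ∂P := by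
    rw [hZ, lintegral_finsetSum' _ fun z _ => hb.aemeasurable_pointWeight z]
    simp only [hb.lintegral_pointWeight]
    exact le_sum_survival hn
  have hsecond : ∫⁻ ω, Z ω ^ 2 ∂P ≤ ENNReal.ofReal C := by
    have h1 : ∀ ω, Z ω ^ 2 = ∑ z ∈ V, ∑ w ∈ V, pointWeight n b z ω * pointWeight n b w ω := by
      intro ω
      rw [sq, hZ, Finset.sum_mul_sum]
    have hmul : ∀ z w, AEMeasurable (fun ω => pointWeight n b z ω * pointWeight n b w ω) P :=
      fun z w => (hb.aemeasurable_pointWeight z).mul (hb.aemeasurable_pointWeight w)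
    simp only [h1]
    rw [lintegral_finsetSum' _ fun z _ => Finset.aemeasurable_fun_sum _ fun w _ => hmul z w]
    calc _ ≤ ∑ z ∈ V, ENNReal.ofReal (2 * (C / 4 ^ n)) := by
          refine Finset.sum_le_sum fun z hz => ?_
          rw [lintegral_finsetSum' _ fun w _ => hmul z w]
          calc _ ≤ ∑ w ∈ V, ENNReal.ofReal
                (2 * pairBound n (max (z.1 - w.1).natAbs (z.2 - w.2).natAbs).size) :=
                Finset.sum_le_sum fun w hw =>
                  hb.lintegral_pointWeight_mul_le hn (dist_lt_of_mem_centralBox hn hz hw)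
            _ = ENNReal.ofReal (2 * ∑ w ∈ V,
                pairBound n (max (z.1 - w.1).natAbs (z.2 - w.2).natAbs).size) := by
                rw [Finset.mul_sum, ENNReal.ofReal_sum_of_nonneg]
                exact fun w _ => mul_nonneg zero_le_two (pairBound_nonneg _ _)
            _ ≤ _ := by
                refine ENNReal.ofReal_le_ofReal (mul_le_mul_of_nonneg_left ?_ zero_le_two)
                exact (sum_pairBound_le hn hz).trans (hsum n hn)
      _ ≤ _ := by
          rw [Finset.sum_const, hV, card_centralBox hn, nsmul_eq_mul, ← ENNReal.ofReal_natCast,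
            ← ENNReal.ofReal_mul (by positivity)]
          refine ENNReal.ofReal_le_ofReal ?_
          have h4 : (4 : ℝ) ^ n = 4 ^ (n - 1) * 4 := by
            rw [← pow_succ, Nat.sub_add_cancel hn]
          rw [h4]
          push_cast
          field_simp
          norm_num
  have hevent : {ω | Z ω ≠ 0} ⊆ {ω | A n ≤ centralMax n hn b ω} := by
    intro ω hω
    obtain ⟨z, hz, hzω⟩ := Finset.exists_ne_zero_of_sum_ne_zero hω
    exact (A_le_mbrw_of_pointWeight_ne_zero hzω).trans
      (Finset.le_sup' (fun z => mbrw n b z ω) hz)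
  have h2 : ENNReal.ofReal (Real.exp (-8) / 48) ^ 2 ≤
      ENNReal.ofReal C * P {ω | A n ≤ centralMax n hn b ω} :=
    calc _ ≤ (∫⁻ ω, Z ω ∂P) ^ 2 := pow_le_pow_left₀ zero_le hfirst 2
      _ ≤ _ := sq_lintegral_le P hZm
      _ ≤ _ := mul_le_mul' hsecond (measure_mono hevent)
  have h3 := ENNReal.toReal_mono (ENNReal.mul_ne_top ENNReal.ofReal_ne_top (measure_ne_top _ _)) h2
  rw [ENNReal.toReal_pow, ENNReal.toReal_mul, ENNReal.toReal_ofReal (by positivity),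
    ENNReal.toReal_ofReal hC.le] at h3
  rw [div_le_iff₀ hC, mul_comm]
  exact h3

end MBRW

theorem mainTheorem6 :
    ∃ δ₀ : ℝ, 0 < δ₀ ∧ δ₀ < 1 ∧
      ∀ (n : ℕ) (hn : 1 ≤ n) (Ω : Type*) [MeasurableSpace Ω] (P : Measure Ω)
        [IsProbabilityMeasure P] (b : ℕ → ℤ × ℤ → Ω → ℝ),
        MBRW.IsWeightFamily P (2 ^ n) b →
          δ₀ ≤ P.real {ω | MBRW.A n ≤ MBRW.centralMax n hn b ω} := by
  obtain ⟨δ, hδ, h⟩ := MBRW.exists_le_measureReal_centralMax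
  refine ⟨min δ (1 / 2), by positivity, (min_le_right _ _).trans_lt (by norm_num), ?_⟩
  intro n hn Ω _ P _ b hb
  exact (min_le_left _ _).trans (h n hn Ω P b hb)
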